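/- **Setting.** Let $\psi:\mathbb R^2\to\mathbb C$ be a $C^2$ function such that * $(1+|u|)^N|\psi(u)|$ is bounded on $\mathbb R^2$ for every $N\in\mathbb N$ ($|\psi|$ decays faster than any rational function); * $\psi$ has two vanishing moments: $\int_{\mathbb R^2} q(u)\,\psi(u)\,du=0$ for every polynomial $q$ in two variables of degree at most $1$; * $\psi$ has two directional vanishing moments in the cone of angles $[-\pi/4,\pi/4]$: for every $\theta\in[-\pi/4,\pi/4]$, every $u_2\in\mathbb R$ and every polynomial $q$ in one variable of degree at most $1$, $\int_{\mathbb R} q(u_1)\,\psi(r_\theta(u_1,u_2))\,du_1=0$, where $r_\theta$ is the rotation of the plane by the angle $\theta$. For $k\in\{0,1,2,3\}$ and $j\in\mathbb Z$ put $\psi_j^k(u)=2^{-2j}\,\psi\big(r_{-k\pi/4}(2^{-j}u)\big)$. Let $\alpha\in[1,2]$. A function $f$ is *uniformly Lipschitz $\alpha$ on a set $\Omega$ with constant $L$* if for every $u\in\Omega$ there is a polynomial $q_u$ of degree smaller than $\alpha$ with $|f(u')-q_u(u')|\le L|u-u'|^\alpha$ for all $u'\in\Omega$. A curve is uniformly Lipschitz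 $\alpha$ if the coordinates of its arc length parametrization are, for some constant, on $\mathbb R$. Let $k\in\{0,1,2,3\}$ and let $\gamma$ be a simple closed curve on the torus $\mathbb R^2/\mathbb Z^2$ which is uniformly Lipschitz $\alpha$ and which, for one of its two orientations, has a unit tangent vector $(\cos\theta,\sin\theta)$ with $\theta\in[(k-1)\pi/4,(k+1)\pi/4]$ wherever it has a tangent (hence everywhere if $\alpha>1$, almost everywhere if $\alpha=1$). Let $f:\mathbb R^2\to\mathbb R$ be a $\mathbb Z^2$-periodic function (a periodic image on $[0,1]^2$) which is uniformly Lipschitz $\alpha$ above and below the edge $\gamma$, that is, for which there is a constant $L$ such that $f$ is uniformly Lipschitz $\alpha$ with constant $L$ on each connected component of the complement in $\mathbb R^2$ of the set of all points lying over $\gamma$. (The values of $f$ on the edge itself are arbitrary.) Let $J\in\mathbb Z$. **Theorem.** For every $s<\alpha$ there exists a constant $C$ such that, for all integers $j\le J$ and all $u\in\mathbb R^2$, the convolution $$f*\psi_j^k(u)=\int_{\mathbb R^2} f(u-v)\,\psi_j^k(v)\,dv$$ is an absolutely convergent integral and satisfies $$|f*\psi_j^k(u)|\le C\,2^{(s-1)j}.$$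 -/

import Mathlib

noncomputable section

/-- The Euclidean plane. -/
abbrev Plane : Type := EuclideanSpace ℝ (Fin 2)

/-- The rotation of the plane by the angle `θ`. -/
def planeRot (θ : ℝ) (u : Plane) : Plane :=
  !₂[Real.cos θ * u 0 - Real.sin θ * u 1, Real.sin θ * u 0 + Real.cos θ * u 1]

/-- The point of the integer lattice with the given coordinates. -/
def latticePoint (n : Fin 2 → ℤ) : Plane := !₂[(n 0 : ℝ), (n 1 : ℝ)]

/-- A periodic image on the unit square, seen as a `ℤ²`-periodic function on the plane. -/
def IsPeriodicImage (f : Plane → ℝ) : Prop :=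
  ∀ (n : Fin 2 → ℤ) (u : Plane), f (u + latticePoint n) = f u

/-! ### Wavelets -/

/-- `ψ` has `m` vanishing moments: it is orthogonal to the polynomials of degree at most `m - 1`. -/
def HasVanishingMoments (m : ℕ) (ψ : Plane → ℂ) : Prop :=
  ∀ q : MvPolynomial (Fin 2) ℝ, q.totalDegree < m →
    ∫ u : Plane, (MvPolynomial.eval (fun i => u i) q) • ψ u = 0

/-- `ψ` has `m` directional vanishing moments in the directions of angle `θ ∈ Θ`: its restriction
to every line of such a direction is orthogonal to the one-variable polynomials of degree at most
`m - 1`. -/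
def HasDirectionalVanishingMoments (m : ℕ) (Θ : Set ℝ) (ψ : Plane → ℂ) : Prop :=
  ∀ θ ∈ Θ, ∀ u₂ : ℝ, ∀ q : Polynomial ℝ, q.degree < m →
    ∫ u₁ : ℝ, (q.eval u₁) • ψ (planeRot θ !₂[u₁, u₂]) = 0

/-- `|ψ|` decays faster than any rational function. -/
def HasRapidDecay (ψ : Plane → ℂ) : Prop :=
  ∀ N : ℕ, ∃ C : ℝ, ∀ u : Plane, (1 + ‖u‖) ^ N * ‖ψ u‖ ≤ C

/-- The rotated and dilated wavelet `ψ_j^k(u) = 2^{-2j} ψ(r_k(2^{-j} u))`, where `r_k` is the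
rotation by the angle `-kπ/4`. -/
def wavelet (ψ : Plane → ℂ) (k : ℕ) (j : ℤ) (u : Plane) : ℂ :=
  ((2 : ℝ) ^ (-2 * j)) • ψ (planeRot (-(k * Real.pi / 4)) ((2 : ℝ) ^ (-j) • u))

/-! ### Images with one edge -/

/-- `f` is uniformly Lipschitz `α` on `Ω` with constant `L`. -/
def UniformlyLipschitzOn (α L : ℝ) (Ω : Set Plane) (f : Plane → ℝ) : Prop :=
  ∀ u ∈ Ω, ∃ q : MvPolynomial (Fin 2) ℝ, (q.totalDegree : ℝ) < α ∧
    ∀ u' ∈ Ω, |f u' - MvPolynomial.eval (fun i => u' i) q| ≤ L * ‖u - u'‖ ^ α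

/-- The parametrized curve `c` is uniformly Lipschitz `α` with constant `L`: both of its
coordinates are. -/
def UniformlyLipschitzCurve (α L : ℝ) (c : ℝ → Plane) : Prop :=
  ∀ (i : Fin 2) (t : ℝ), ∃ q : Polynomial ℝ, (q.natDegree : ℝ) < α ∧
    ∀ t' : ℝ, |c t' i - q.eval t'| ≤ L * |t - t'| ^ α

/-- `c` is the lift to the plane of a simple closed curve of length `ℓ` on the torus `ℝ²/ℤ²`,
parametrized by arc length, which is uniformly Lipschitz `α` and whose tangents (wherever they
exist, hence everywhere if `α > 1` and almost everywhere if `α = 1`) have an angle in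
`[(k-1)π/4, (k+1)π/4]`. -/
structure IsEdgeCurve (α : ℝ) (k : ℕ) (ℓ : ℝ) (c : ℝ → Plane) : Prop where
  length_pos : 0 < ℓ
  closed : ∃ m : Fin 2 → ℤ, ∀ t : ℝ, c (t + ℓ) = c t + latticePoint m
  simple : ∀ (t t' : ℝ) (n : Fin 2 → ℤ), c t' = c t + latticePoint n → ∃ i : ℤ, t' = t + i * ℓ
  lipschitz : ∃ L : ℝ, UniformlyLipschitzCurve α L c
  tangent : ∀ t : ℝ, DifferentiableAt ℝ c t →
    ∃ θ ∈ Set.Icc (((k : ℝ) - 1) * Real.pi / 4) (((k : ℝ) + 1) * Real.pi / 4),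
      deriv c t = !₂[Real.cos θ, Real.sin θ]

/-- The union of all the lifts to the plane of the curve of the torus lifted by `c`. -/
def edgeSet (c : ℝ → Plane) : Set Plane :=
  {x | ∃ (t : ℝ) (n : Fin 2 → ℤ), x = c t + latticePoint n}

/-- `f` is uniformly Lipschitz `α` above and below the edge: with a common constant, on each of the
regions into which the lifts of the edge cut the plane. Nothing is required of the values of `f` on
the edge itself. -/
def IsRegularAwayFromEdge (α : ℝ) (c : ℝ → Plane) (f : Plane → ℝ) : Prop :=
  ∃ L : ℝ, ∀ x ∈ (edgeSet c)ᶜ, UniformlyLipschitzOn α L (connectedComponentIn (edgeSet c)ᶜ x) f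

end

/-! ### Rotations and orthonormal coordinates of the plane. -/

noncomputable section

open MeasureTheory

/-! Put ε = 2^j. Rotating by kπ/4 and rescaling (`convolution_wavelet_eq`) turns the convolution
into ∫ F(u - εw) ψ(w) dw, where F is the rotated image and its edge E has tangents of angle in
[-π/4, π/4]. Off E, F is bounded by some M, so the integral is bounded by M ∫ |ψ|. This settles s <
1, since ε^(s-1) is bounded below for ε ≤ 2^J. The remaining case s ≥ 1 forces α > 1.

For α > 1, compare F with a simpler function on the ball of radius ρ around u. F is Lipschitz along
short segments avoiding E (`IsSegmentRegular.exists_lipschitz`). If E misses the ball, F is constant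
there up to O(ρ), and constants integrate to zero against ψ. Otherwise E lies, near u, within O(ρ^α)
of a tangent line of admissible angle (`IsEdgeCurve.exists_hasTangentLines`). Off that strip F is
constant on either side of the line up to O(ρ), and a function depending only on the coordinate
normal to the line integrates to zero against ψ by the directional moments
(`HasDirectionalVanishingMoments.integral_smul_eq_zero`).

The errors (`exists_bound_integral_edge`) are ρ from the approximation, (ρ/ε)^(-N) from the tail of
ψ, and ρ^α/ε from the strip, whose width is divided by ε in the variable w. The choice ρ = ε^(s/α)
makes the last one ε^(s-1) and dominates the other two for N large (`exists_exponent_bound`).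
Zeroth-order approximation suffices because s < α ≤ 2 gives s/α ≥ s - 1.

The geometric input is that E is locally a graph of slope at most 1 over the first axis. Hence E is
null, and every point off E sees a vertical triangle of fixed size free of E, which yields uniform
bounds on F and on its linear parts. -/

/-- The rotation of the plane as a linear isometric equivalence. -/
def planeRotEquiv (θ : ℝ) : Plane ≃ₗᵢ[ℝ] Plane where
  toFun := planeRot θ
  invFun := planeRot (-θ)
  map_add' u v := by
    ext i; fin_cases i <;> simp [planeRot] <;> ring
  map_smul' a u := by
    ext i; fin_cases i <;> simp [planeRot] <;> ring
  left_inv u := by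
    have h := Real.sin_sq_add_cos_sq θ
    ext i; fin_cases i <;> simp [planeRot] <;> grind
  right_inv u := by
    have h := Real.sin_sq_add_cos_sq θ
    ext i; fin_cases i <;> simp [planeRot] <;> grind
  norm_map' u := by
    have h := Real.sin_sq_add_cos_sq θ
    simp only [EuclideanSpace.norm_eq, LinearEquiv.coe_mk, LinearMap.coe_mk, AddHom.coe_mk,
      Fin.sum_univ_two, Real.norm_eq_abs, sq_abs, planeRot]
    congr 1
    simp
    grind

@[simp] lemma planeRotEquiv_apply (θ : ℝ) (u : Plane) : planeRotEquiv θ u = planeRot θ u := rfl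

lemma abs_coord_le_norm (u : Plane) (i : Fin 2) : |u i| ≤ ‖u‖ := PiLp.norm_apply_le u i

lemma norm_le_abs_add_abs (u : Plane) : ‖u‖ ≤ |u 0| + |u 1| := by
  rw [EuclideanSpace.norm_eq, Fin.sum_univ_two]
  apply Real.sqrt_le_iff.2
  refine ⟨by positivity, ?_⟩
  simp only [Real.norm_eq_abs]
  nlinarith [abs_nonneg (u 0), abs_nonneg (u 1)]

/-- The coordinate normal to the direction of angle `θ`. -/
def normalCoord (θ : ℝ) : Plane →ₗ[ℝ] ℝ where
  toFun u := -Real.sin θ * u 0 + Real.cos θ * u 1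
  map_add' u v := by simp; ring
  map_smul' a u := by simp; ring

lemma normalCoord_apply (θ : ℝ) (u : Plane) :
    normalCoord θ u = -Real.sin θ * u 0 + Real.cos θ * u 1 := rfl

lemma normalCoord_planeRot (θ : ℝ) (u : Plane) : normalCoord θ (planeRot θ u) = u 1 := by
  have h := Real.sin_sq_add_cos_sq θ
  simp [normalCoord_apply, planeRot]
  grind

lemma continuous_normalCoord (θ : ℝ) : Continuous (normalCoord θ) :=
  (normalCoord θ).continuous_of_finiteDimensional

/-- Orthonormal coordinates whose first axis has angle `θ`. -/
def rotatedCoords (θ : ℝ) : ℝ × ℝ ≃ᵐ Plane :=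
  (MeasurableEquiv.finTwoArrow.symm.trans (MeasurableEquiv.toLp 2 (Fin 2 → ℝ))).trans
    (planeRotEquiv θ).toMeasurableEquiv

lemma rotatedCoords_apply (θ : ℝ) (z : ℝ × ℝ) :
    rotatedCoords θ z = planeRot θ !₂[z.1, z.2] := rfl

lemma measurePreserving_rotatedCoords (θ : ℝ) : MeasurePreserving (rotatedCoords θ) := by
  have h1 := (volume_preserving_finTwoArrow ℝ).symm
  have h2 := (PiLp.volume_preserving_toLp (Fin 2))
  exact (planeRotEquiv θ).measurePreserving.comp (h2.comp h1)

lemma integral_rotatedCoords {G : Type*} [NormedAddCommGroup G] [NormedSpace ℝ G] (θ : ℝ)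
    (g : Plane → G) : ∫ z, g (rotatedCoords θ z) = ∫ u, g u :=
  (measurePreserving_rotatedCoords θ).integral_comp' g

/-! ### Integral estimates and cancellation for the wavelet. -/

section Wavelet

variable {ψ : Plane → ℂ}

lemma HasRapidDecay.norm_le (h : HasRapidDecay ψ) (N : ℕ) :
    ∃ C, 0 ≤ C ∧ ∀ u, ‖ψ u‖ ≤ C * (1 + ‖u‖) ^ (-(N : ℝ)) := by
  obtain ⟨C, hC⟩ := h N
  refine ⟨C, le_trans (by positivity) (hC 0), fun u => ?_⟩
  rw [Real.rpow_neg (by positivity), Real.rpow_natCast, ← div_eq_mul_inv, le_div_iff₀ (by positivity),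
    mul_comm]
  exact hC u

lemma integrable_one_add_norm_plane : Integrable fun u : Plane => (1 + ‖u‖) ^ (-(3 : ℝ)) :=
  integrable_one_add_norm (by simp; norm_num)

lemma HasRapidDecay.integrable (h : HasRapidDecay ψ) (hc : Continuous ψ) : Integrable ψ := by
  obtain ⟨C, -, hC⟩ := h.norm_le 3
  exact (integrable_one_add_norm_plane.const_mul C).mono' hc.aestronglyMeasurable
    (Filter.Eventually.of_forall fun u => by simpa using hC u)

lemma HasRapidDecay.setIntegral_norm_ge_le (h : HasRapidDecay ψ) (hc : Continuous ψ) (N : ℕ) :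
    ∃ C, 0 ≤ C ∧ ∀ R, 0 < R → ∫ w in {w | R ≤ ‖w‖}, ‖ψ w‖ ≤ C * R ^ (-(N : ℝ)) := by
  obtain ⟨C, hC0, hC⟩ := h.norm_le (N + 3)
  refine ⟨C * ∫ u : Plane, (1 + ‖u‖) ^ (-(3 : ℝ)), by positivity, fun R hR => ?_⟩
  have hm : MeasurableSet {w : Plane | R ≤ ‖w‖} := measurableSet_le measurable_const measurable_norm
  have hi := (integrable_one_add_norm_plane.const_mul (C * R ^ (-(N : ℝ))))
  calc ∫ w in {w | R ≤ ‖w‖}, ‖ψ w‖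
      ≤ ∫ w in {w : Plane | R ≤ ‖w‖}, C * R ^ (-(N : ℝ)) * (1 + ‖w‖) ^ (-(3 : ℝ)) := by
        refine setIntegral_mono_on (h.integrable hc).norm.integrableOn hi.integrableOn hm
          fun w hw => (hC w).trans ?_
        rw [mul_assoc]
        gcongr
        rw [Nat.cast_add, neg_add, Real.rpow_add (by positivity)]
        refine mul_le_mul ?_ (le_of_eq (by norm_num)) (by positivity) (by positivity)
        exact Real.rpow_le_rpow_of_nonpos hR (le_add_of_nonneg_of_le zero_le_one hw) (by simp)
    _ ≤ ∫ w : Plane, C * R ^ (-(N : ℝ)) * (1 + ‖w‖) ^ (-(3 : ℝ)) :=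
        setIntegral_le_integral hi (Filter.Eventually.of_forall fun w => by positivity)
    _ = _ := by rw [integral_const_mul]; ring

/-- In coordinates adapted to θ, |ψ| is dominated by an integrable function of the tangential
coordinate alone, so the strip contributes at most a constant times its width 2r, uniformly in angle
and position. -/
lemma HasRapidDecay.setIntegral_strip_le (h : HasRapidDecay ψ) :
    ∃ C, 0 ≤ C ∧ ∀ θ b r, 0 ≤ r →
      ∫ w in {w | |normalCoord θ w - b| ≤ r}, ‖ψ w‖ ≤ C * r := by
  obtain ⟨C, hC0, hC⟩ := h.norm_le 2
  have hi1 : Integrable fun x : ℝ => (1 + ‖x‖) ^ (-(2 : ℝ)) :=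
    integrable_one_add_norm (by simp)
  refine ⟨C * (∫ x : ℝ, (1 + ‖x‖) ^ (-(2 : ℝ))) * 2, by positivity, fun θ b r hr => ?_⟩
  have hm : MeasurableSet {w : Plane | |normalCoord θ w - b| ≤ r} :=
    (isClosed_le ((continuous_normalCoord θ).sub continuous_const).abs
      continuous_const).measurableSet
  have hi2 : Integrable ((Set.Icc (b - r) (b + r)).indicator fun _ => (1 : ℝ)) :=
    (integrable_indicator_iff measurableSet_Icc).2 (by simp)
  have hi := (hi1.mul_prod hi2).const_mul C
  rw [← integral_indicator hm, ← integral_rotatedCoords θ]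
  calc _ ≤ ∫ z : ℝ × ℝ, C * ((1 + ‖z.1‖) ^ (-(2 : ℝ)) *
          (Set.Icc (b - r) (b + r)).indicator (fun _ => (1 : ℝ)) z.2) := by
        refine integral_mono_of_nonneg (Filter.Eventually.of_forall fun z => ?_) hi
          (Filter.Eventually.of_forall fun z => ?_)
        · exact Set.indicator_nonneg (fun _ _ => norm_nonneg _) _
        · simp only [rotatedCoords_apply, Set.indicator, Set.mem_ofPred_eq, normalCoord_planeRot]
          have e : |(!₂[z.1, z.2] : Plane) 1 - b| ≤ r ↔ z.2 ∈ Set.Icc (b - r) (b + r) := by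
            simp only [abs_le, Set.mem_Icc, Matrix.cons_val_one,
              Matrix.cons_val_fin_one]
            constructor <;> rintro ⟨_, _⟩ <;> constructor <;> linarith
          simp only [e]
          split_ifs
          · rw [mul_one]
            refine (hC _).trans ?_
            have hn : ‖planeRot θ !₂[z.1, z.2]‖ = ‖(!₂[z.1, z.2] : Plane)‖ :=
              (planeRotEquiv θ).norm_map _
            rw [hn]
            refine mul_le_mul_of_nonneg_left ?_ hC0
            refine Real.rpow_le_rpow_of_nonpos (by positivity) ?_ (by norm_num)
            have := abs_coord_le_norm !₂[z.1, z.2] 0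
            simpa using this
          · simp
    _ = _ := by
        rw [integral_const_mul]
        change C * ∫ z, _ ∂(volume.prod volume) = _
        rw [integral_prod_mul (fun x : ℝ => (1 + ‖x‖) ^ (-(2 : ℝ))),
          integral_indicator measurableSet_Icc]
        simp
        rw [max_eq_left (by linarith)]
        ring

/-- By Fubini along the lines of angle θ: g is constant on each line, and ψ has zero integral there.
-/
lemma HasDirectionalVanishingMoments.integral_smul_eq_zero {m : ℕ} (hm : 0 < m) {Θ : Set ℝ}
    (h : HasDirectionalVanishingMoments m Θ ψ) {θ : ℝ} (hθ : θ ∈ Θ) (g : ℝ → ℝ) :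
    ∫ w, g (normalCoord θ w) • ψ w = 0 := by
  rw [← integral_rotatedCoords θ]
  by_cases hi : Integrable (fun z => g (normalCoord θ (rotatedCoords θ z)) • ψ (rotatedCoords θ z))
  · change ∫ z, _ ∂(volume.prod volume) = _
    rw [integral_prod_symm _ hi]
    refine integral_eq_zero_of_ae (Filter.Eventually.of_forall fun y => ?_)
    have h1 := h θ hθ y (Polynomial.C 1)
      (Polynomial.degree_C_le.trans_lt (by exact_mod_cast hm))
    simp only [Polynomial.eval_C, one_smul] at h1
    simp only [rotatedCoords_apply, normalCoord_planeRot]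
    change ∫ x, g y • ψ (planeRot θ !₂[x, y]) = 0
    rw [integral_smul, h1, smul_zero]
  -- Without integrability the integral is 0 by convention, so g needs no hypothesis.
  · exact integral_undef hi

lemma HasVanishingMoments.integral_eq_zero {m : ℕ} (hm : 0 < m)
    (h : HasVanishingMoments m ψ) : ∫ w, ψ w = 0 := by
  simpa using h 1 (by simpa using hm)

end Wavelet

/-! ### Consequences of the slope bound: null edge, bounded and locally Lipschitz image. -/

/-- Close points of `E` lie in the double cone of slopes in `[-1, 1]` around one another. -/
def HasLocalSlopeBound (δ : ℝ) (E : Set Plane) : Prop :=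
  ∀ x ∈ E, ∀ y ∈ E, ‖y - x‖ < δ → |y 1 - x 1| ≤ |y 0 - x 0|

/-- `F` has an expansion of order `α` at each point off `E`, along the segments that avoid `E`. -/
def IsSegmentRegular (α L : ℝ) (E : Set Plane) (F : Plane → ℝ) : Prop :=
  ∀ u ∉ E, ∃ a : Plane →ₗ[ℝ] ℝ, ∀ u', Disjoint (segment ℝ u u') E →
    |F u' - F u - a (u' - u)| ≤ L * ‖u' - u‖ ^ α

section

variable {α δ L M : ℝ} {E : Set Plane} {F : Plane → ℝ}

/-- Two points of E on one vertical line at distance less than δ coincide. Vertical sections are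
therefore countable, counted by ⌊y/δ⌋, and Fubini concludes. -/
lemma HasLocalSlopeBound.volume_eq_zero (hδ : 0 < δ) (hE : HasLocalSlopeBound δ E)
    (hcl : IsClosed E) : volume E = 0 := by
  rw [← (measurePreserving_rotatedCoords 0).measure_preimage_equiv]
  have hm : MeasurableSet (rotatedCoords 0 ⁻¹' E) :=
    (rotatedCoords 0).measurable hcl.measurableSet
  change (volume.prod volume) _ = 0
  rw [Measure.measure_prod_null hm]
  refine Filter.Eventually.of_forall fun x => ?_
  refine Set.Countable.measure_zero ?_ _
  refine Set.MapsTo.countable_of_injOn (f := fun y : ℝ => ⌊y / δ⌋)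
    (Set.mapsTo_univ _ _) ?_ Set.countable_univ
  intro y hy y' hy' h
  simp only [Set.mem_preimage, rotatedCoords_apply] at hy hy'
  have h1 : |y / δ - y' / δ| < 1 := Int.abs_sub_lt_one_of_floor_eq_floor h
  rw [← sub_div, abs_div, abs_of_pos hδ, div_lt_one hδ] at h1
  have h2 : ‖planeRot 0 !₂[x, y] - planeRot 0 !₂[x, y']‖ < δ := by
    refine (norm_le_abs_add_abs _).trans_lt ?_
    simpa [planeRot] using h1
  have h3 := hE _ hy' _ hy h2
  simp [planeRot] at h3
  linarith

/-- Off `E`, at least one of the upward and downward vertical triangles avoids `E`. -/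
lemma HasLocalSlopeBound.exists_triangle (hE : HasLocalSlopeBound δ E) {u : Plane}
    (hu : u ∉ E) : ∃ σ : ℝ, (σ = 1 ∨ σ = -1) ∧
      ∀ v : Plane, |v 0| ≤ v 1 / 2 → v 1 ≤ δ / 4 → Disjoint (segment ℝ u (u + σ • v)) E := by
  by_contra! H
  -- The triangles are star-shaped about u, so a segment meeting E gives a point of E in the
  -- triangle itself. Points of E in both triangles would differ by a vector steeper than slope 1
  -- and shorter than δ.
  have key : ∀ σ : ℝ, (σ = 1 ∨ σ = -1) →
      ∃ v : Plane, |v 0| ≤ v 1 / 2 ∧ v 1 ≤ δ / 4 ∧ u + σ • v ∈ E := by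
    intro σ hσ
    obtain ⟨v, h0, h1, h2⟩ := H σ hσ
    obtain ⟨x, hx, hxE⟩ := Set.not_disjoint_iff.1 h2
    rw [segment_eq_image'] at hx
    obtain ⟨s, hs, rfl⟩ := hx
    have hv1 : 0 ≤ v 1 := by linarith [abs_nonneg (v 0)]
    refine ⟨s • v, ?_, ?_, ?_⟩
    · simp only [PiLp.smul_apply, smul_eq_mul, abs_mul, abs_of_nonneg hs.1]
      nlinarith [hs.1]
    · simp only [PiLp.smul_apply, smul_eq_mul]
      nlinarith [hs.2]
    · convert hxE using 1
      simp [smul_smul, mul_comm]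
  obtain ⟨v, hv0, hv1, hv⟩ := key 1 (Or.inl rfl)
  obtain ⟨w, hw0, hw1, hw⟩ := key (-1) (Or.inr rfl)
  have h0 := abs_nonneg (v 0)
  have h0' := abs_nonneg (w 0)
  have h00 := abs_add_le (v 0) (w 0)
  have hd : u + (1 : ℝ) • v - (u + (-1 : ℝ) • w) = v + w := by simp
  rcases (show 0 ≤ v 1 by linarith).eq_or_lt with h | h
  · have : v = 0 := by
      ext i; fin_cases i
      · exact abs_eq_zero.1 (le_antisymm (by simpa [← h] using hv0) h0)
      · exact h.symm
    simp [this] at hv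
    exact hu hv
  · have h3 := hE _ hw _ hv <| by
      rw [hd]
      refine (norm_le_abs_add_abs _).trans_lt ?_
      simp only [PiLp.add_apply]
      rw [abs_of_nonneg (by linarith : 0 ≤ v 1 + w 1)]
      linarith
    have e : ∀ i, (u + (1 : ℝ) • v) i - (u + (-1 : ℝ) • w) i = v i + w i := by
      intro i; simp
    rw [e, e, abs_of_nonneg (by linarith : 0 ≤ v 1 + w 1)] at h3
    linarith

/-- The centre x may lie on E. Every u off E near x sees, through its free triangle, one of the two
fixed points x ± (0, δ/8), and the expansion at that point bounds F u. -/
lemma IsSegmentRegular.exists_bound_nhds (hδ : 0 < δ) (hE : HasLocalSlopeBound δ E)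
    (hα : 0 ≤ α) (hF : IsSegmentRegular α L E F) (hL : 0 ≤ L) (x : Plane) :
    ∃ r > 0, ∃ B, ∀ u ∈ Metric.ball x r, u ∉ E → |F u| ≤ B := by
  have hz : ∀ z : Plane, ∃ B, 0 ≤ B ∧ ∀ u, ‖u - z‖ ≤ δ → Disjoint (segment ℝ z u) E →
      |F u| ≤ B := by
    intro z
    by_cases hzE : z ∈ E
    · exact ⟨0, le_rfl, fun u _ h =>
        absurd hzE (Set.disjoint_left.1 h (left_mem_segment ℝ z u))⟩
    obtain ⟨a, ha⟩ := hF z hzE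
    refine ⟨|F z| + ‖LinearMap.toContinuousLinearMap a‖ * δ + L * δ ^ α, by positivity,
      fun u hu hd => ?_⟩
    have h1 := ha u hd
    have h2 : |a (u - z)| ≤ ‖LinearMap.toContinuousLinearMap a‖ * δ :=
      ((LinearMap.toContinuousLinearMap a).le_opNorm (u - z)).trans (by gcongr)
    have h3 : L * ‖u - z‖ ^ α ≤ L * δ ^ α := by gcongr
    have h4 : |F u| ≤ |F u - F z - a (u - z)| + |F z| + |a (u - z)| := by
      calc |F u| = |(F u - F z - a (u - z)) + F z + a (u - z)| := by ring_nf
        _ ≤ _ := (abs_add_le _ _).trans (by gcongr; exact abs_add_le _ _)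
    linarith
  choose B hB0 hB using hz
  refine ⟨δ / 32, by positivity,
    B (x + !₂[0, δ / 8]) + B (x + (-1 : ℝ) • !₂[0, δ / 8]), fun u hu huE => ?_⟩
  obtain ⟨σ, hσ, h⟩ := hE.exists_triangle huE
  rw [mem_ball_iff_norm] at hu
  have c0 := (abs_coord_le_norm (u - x) 0).trans_lt hu
  have c1 := (abs_coord_le_norm (u - x) 1).trans_lt hu
  rw [abs_lt] at c0 c1
  simp only [PiLp.sub_apply] at c0 c1
  have hσσ : σ * σ = 1 := by rcases hσ with rfl | rfl <;> norm_num
  have hd := h (σ • (x + σ • !₂[0, δ / 8] - u))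
    (by
      simp [mul_add, mul_sub, ← mul_assoc, hσσ]
      rw [abs_le]
      rcases hσ with rfl | rfl <;> constructor <;> linarith)
    (by
      simp [mul_add, mul_sub, ← mul_assoc, hσσ]
      rcases hσ with rfl | rfl <;> linarith)
  rw [smul_smul, hσσ, one_smul, add_sub_cancel, segment_symm] at hd
  have hn : ‖u - (x + σ • !₂[0, δ / 8])‖ ≤ δ := by
    refine (norm_le_abs_add_abs _).trans ?_
    have e0 : |(u - (x + σ • !₂[0, δ / 8])) 0| ≤ δ / 2 := by
      simp
      rw [abs_le]; constructor <;> linarith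
    have e1 : |(u - (x + σ • !₂[0, δ / 8])) 1| ≤ δ / 2 := by
      simp
      rw [abs_le]; rcases hσ with rfl | rfl <;> constructor <;> linarith
    linarith
  have := hB _ u hn hd
  rcases hσ with rfl | rfl
  · rw [one_smul] at this
    linarith [hB0 (x + (-1 : ℝ) • !₂[0, δ / 8])]
  · linarith [hB0 (x + !₂[0, δ / 8])]

lemma IsSegmentRegular.exists_bound (hδ : 0 < δ) (hE : HasLocalSlopeBound δ E)
    (hα : 0 ≤ α) (hF : IsSegmentRegular α L E F) (hL : 0 ≤ L) {R : ℝ}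
    (hper : ∀ x ∉ E, ∃ y ∉ E, ‖y‖ ≤ R ∧ F y = F x) : ∃ M, 0 ≤ M ∧ ∀ x ∉ E, |F x| ≤ M := by
  have hloc := hF.exists_bound_nhds hδ hE hα hL
  have : ∃ M, ∀ x ∈ Metric.closedBall (0 : Plane) R, x ∉ E → |F x| ≤ M := by
    refine (isCompact_closedBall (0 : Plane) R).induction_on
      (p := fun S => ∃ M, ∀ x ∈ S, x ∉ E → |F x| ≤ M) ⟨0, by simp⟩ ?_ ?_ ?_
    · rintro S T hST ⟨M, hM⟩
      exact ⟨M, fun x hx => hM x (hST hx)⟩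
    · rintro S T ⟨M, hM⟩ ⟨M', hM'⟩
      refine ⟨max M M', ?_⟩
      rintro x (hx | hx) hxE
      · exact (hM x hx hxE).trans (le_max_left _ _)
      · exact (hM' x hx hxE).trans (le_max_right _ _)
    · intro x _
      obtain ⟨r, hr, B, hB⟩ := hloc x
      exact ⟨Metric.ball x r, mem_nhdsWithin_of_mem_nhds (Metric.ball_mem_nhds x hr), B, hB⟩
  obtain ⟨M, hM⟩ := this
  refine ⟨max M 0, le_max_right _ _, fun x hx => ?_⟩
  obtain ⟨y, hyE, hyR, hy⟩ := hper x hx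
  rw [← hy]
  exact (hM y (by simpa using hyR) hyE).trans (le_max_left _ _)

lemma abs_linearMap_plane_le (a : Plane →ₗ[ℝ] ℝ) (w : Plane) :
    |a w| ≤ (|a !₂[1, 0]| + |a !₂[0, 1]|) * ‖w‖ := by
  have : w = w 0 • !₂[1, 0] + w 1 • !₂[0, 1] := by
    ext i; fin_cases i <;> simp
  have h : a w = w 0 * a !₂[1, 0] + w 1 * a !₂[0, 1] := by
    conv_lhs => rw [this]
    rw [map_add, map_smul, map_smul]; rfl
  rw [h]
  refine (abs_add_le _ _).trans ?_
  rw [abs_mul, abs_mul]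
  nlinarith [abs_coord_le_norm w 0, abs_coord_le_norm w 1, abs_nonneg (a !₂[1, 0]),
    abs_nonneg (a !₂[0, 1])]

/-- The point is uniformity of the linear parts. On the free triangle of size δ/4 at u, F and the
remainder are bounded, hence so is a; the vectors (0, t) and (t/2, t) of that triangle span the
plane. -/
lemma IsSegmentRegular.exists_lipschitz (hδ : 0 < δ) (hE : HasLocalSlopeBound δ E)
    (hα : 1 ≤ α) (hF : IsSegmentRegular α L E F) (hL : 0 ≤ L)
    (hM : ∀ x ∉ E, |F x| ≤ M) :
    ∃ A, 0 ≤ A ∧ ∀ u u', Disjoint (segment ℝ u u') E → ‖u' - u‖ ≤ 1 →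
      |F u' - F u| ≤ A * ‖u' - u‖ := by
  set t := δ / 4 with ht
  have ht0 : 0 < t := by positivity
  set D := |2 * M| + L * (2 * t) ^ α with hD
  have hD0 : 0 ≤ D := by positivity
  refine ⟨(4 * D / t + D / t) + L, by positivity, fun u u' hd hn => ?_⟩
  have huE : u ∉ E := Set.disjoint_left.1 hd (left_mem_segment ℝ u u')
  obtain ⟨a, ha⟩ := hF u huE
  obtain ⟨σ, hσ, h⟩ := hE.exists_triangle huE
  have hσ1 : |σ| = 1 := by rcases hσ with rfl | rfl <;> norm_num
  have key : ∀ v : Plane, |v 0| ≤ v 1 / 2 → v 1 ≤ t → |a v| ≤ D := by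
    intro v hv0 hv1
    have hdis := h v hv0 hv1
    have h1 := ha _ hdis
    have h2 := hM u huE
    have h3 := hM _ (Set.disjoint_left.1 hdis (right_mem_segment ℝ _ _))
    rw [add_sub_cancel_left, map_smul, smul_eq_mul, norm_smul, Real.norm_eq_abs, hσ1,
      one_mul] at h1
    have hv : ‖v‖ ≤ 2 * t := by
      refine (norm_le_abs_add_abs v).trans ?_
      rw [abs_of_nonneg (by linarith [abs_nonneg (v 0)] : 0 ≤ v 1)]
      linarith
    have h4 : L * ‖v‖ ^ α ≤ L * (2 * t) ^ α := by gcongr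
    have h5 : |a v| = |σ * a v| := by rw [abs_mul, hσ1, one_mul]
    have h6 := le_abs_self (2 * M)
    rw [h5, abs_le]
    rw [abs_le] at h1 h2 h3
    constructor <;> linarith
  have k1 := key (t • !₂[0, 1]) (by simp; positivity) (by simp)
  have k2 := key (t • !₂[1 / 2, 1]) (by simp [abs_of_pos ht0]; linarith) (by simp)
  have e1 : |a !₂[0, 1]| ≤ D / t := by
    rw [le_div_iff₀ ht0, mul_comm]
    rwa [map_smul, smul_eq_mul, abs_mul, abs_of_pos ht0] at k1
  have e0 : |a !₂[1, 0]| ≤ 4 * D / t := by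
    rw [le_div_iff₀ ht0, mul_comm]
    have : t • (!₂[1, 0] : Plane) = (2 : ℝ) • (t • !₂[1 / 2, 1] - t • !₂[0, 1]) := by
      ext i; fin_cases i <;> simp
      ring
    have h2 : t * a !₂[1, 0] = 2 * (a (t • !₂[1 / 2, 1]) - a (t • !₂[0, 1])) := by
      rw [← smul_eq_mul, ← map_smul, this, map_smul, map_sub, smul_eq_mul]
    have h3 : t * |a !₂[1, 0]| = |t * a !₂[1, 0]| := by rw [abs_mul, abs_of_pos ht0]
    rw [h3, h2, abs_le]
    rw [abs_le] at k1 k2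
    constructor <;> linarith
  have h1 := ha u' hd
  have h2 := abs_linearMap_plane_le a (u' - u)
  have h3 : ‖u' - u‖ ^ α ≤ ‖u' - u‖ :=
    Real.rpow_le_self_of_le_one (norm_nonneg _) hn hα
  have h4 : |F u' - F u| ≤ |F u' - F u - a (u' - u)| + |a (u' - u)| := by
    simpa using abs_add_le (F u' - F u - a (u' - u)) (a (u' - u))
  have h5 : (|a !₂[1, 0]| + |a !₂[0, 1]|) * ‖u' - u‖ ≤ (4 * D / t + D / t) * ‖u' - u‖ := by
    gcongr
  have h6 : L * ‖u' - u‖ ^ α ≤ L * ‖u' - u‖ := by gcongr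
  linarith

lemma IsSegmentRegular.aestronglyMeasurable (hα : 0 < α) (hF : IsSegmentRegular α L E F)
    (hcl : IsClosed E) (h0 : volume E = 0) : AEStronglyMeasurable F := by
  have hcont : ContinuousOn F Eᶜ := by
    intro u hu
    refine ContinuousAt.continuousWithinAt ?_
    obtain ⟨a, ha⟩ := hF u hu
    obtain ⟨r, hr, hball⟩ := Metric.isOpen_iff.1 hcl.isOpen_compl u hu
    have hlim : Filter.Tendsto
        (fun u' => |a (u' - u)| + L * ‖u' - u‖ ^ α) (nhds u) (nhds 0) := by
      have hac : Continuous a := a.continuous_of_finiteDimensional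
      have : Continuous (fun u' => |a (u' - u)| + L * ‖u' - u‖ ^ α) := by
        refine Continuous.add (by fun_prop) (continuous_const.mul ?_)
        exact (by fun_prop : Continuous fun u' => ‖u' - u‖).rpow_const fun _ => Or.inr hα.le
      simpa [Real.zero_rpow hα.ne'] using this.tendsto u
    rw [ContinuousAt, tendsto_iff_norm_sub_tendsto_zero]
    refine squeeze_zero' (Filter.Eventually.of_forall fun _ => norm_nonneg _) ?_ hlim
    filter_upwards [Metric.ball_mem_nhds u hr] with u' hu'
    have h1 := ha u' (Set.disjoint_left.2 fun x hx => hball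
      ((convex_ball u r).segment_subset (Metric.mem_ball_self hr) hu' hx))
    have h4 : |F u' - F u| ≤ |F u' - F u - a (u' - u)| + |a (u' - u)| := by
      simpa using abs_add_le (F u' - F u - a (u' - u)) (a (u' - u))
    rw [Real.norm_eq_abs]
    linarith
  have := hcont.aestronglyMeasurable (μ := volume) hcl.isOpen_compl.measurableSet
  rwa [Measure.restrict_eq_self_of_ae_mem (s := Eᶜ) (measure_eq_zero_iff_ae_notMem.1 h0)] at this

end

/-! ### The localized estimate for the integral against the wavelet. -/

/-- Near each of its points, `E` is at distance of order `α` from a line of angle in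
`[-π/4, π/4]`. -/
def HasTangentLines (α δ K : ℝ) (E : Set Plane) : Prop :=
  ∀ p ∈ E, ∃ θ ∈ Set.Icc (-(Real.pi / 4)) (Real.pi / 4), ∀ q ∈ E, ‖q - p‖ < δ →
    |normalCoord θ (q - p)| ≤ K * ‖q - p‖ ^ α

section

variable {ψ : Plane → ℂ} {α δ K L M A : ℝ} {E : Set Plane} {F : Plane → ℝ}

lemma quasiMeasurePreserving_sub_smul (u : Plane) {ε : ℝ} (hε : 0 < ε) :
    Measure.QuasiMeasurePreserving (fun w : Plane => u - ε • w) := by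
  refine ⟨by fun_prop, Measure.AbsolutelyContinuous.mk fun s hs h => ?_⟩
  rw [Measure.map_apply (by fun_prop) hs]
  have : (fun w : Plane => u - ε • w) ⁻¹' s = (fun w => ε • w) ⁻¹' ((fun w => u - w) ⁻¹' s) := rfl
  have h' : volume ((fun w => u - w) ⁻¹' s) = 0 :=
    ((Measure.measurePreserving_sub_left volume u).measure_preimage hs.nullMeasurableSet).trans h
  rw [this, Measure.addHaar_preimage_smul _ hε.ne', h', mul_zero]

/-- Since H integrates to zero against ψ, only G - H matters: it is at most a on the good region,
and at most B on the tail and on the strip. -/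
lemma norm_integral_smul_le_of_approx (hi : Integrable ψ) {G H : Plane → ℝ} {θ a B R b r : ℝ}
    (ha : 0 ≤ a) (hB : 0 ≤ B)
    (hG : Integrable fun w => G w • ψ w) (hH : Integrable fun w => H w • ψ w)
    (hH0 : ∫ w, H w • ψ w = 0) (hfar : ∀ᵐ w, |G w - H w| ≤ B)
    (hnear : ∀ᵐ w, ‖w‖ < R → r < |normalCoord θ w - b| → |G w - H w| ≤ a) :
    ‖∫ w, G w • ψ w‖ ≤ a * (∫ w, ‖ψ w‖) + B * (∫ w in {w | R ≤ ‖w‖}, ‖ψ w‖) +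
      B * (∫ w in {w | |normalCoord θ w - b| ≤ r}, ‖ψ w‖) := by
  have hm1 : MeasurableSet {w : Plane | R ≤ ‖w‖} := measurableSet_le measurable_const measurable_norm
  have hm2 : MeasurableSet {w : Plane | |normalCoord θ w - b| ≤ r} :=
    (isClosed_le ((continuous_normalCoord θ).sub continuous_const).abs
      continuous_const).measurableSet
  have e : ∫ w, G w • ψ w = ∫ w, (G w • ψ w - H w • ψ w) := by
    rw [integral_sub hG hH, hH0, sub_zero]
  rw [e, ← integral_indicator hm1, ← integral_indicator hm2, ← integral_const_mul,
    ← integral_const_mul, ← integral_const_mul, ← integral_add, ← integral_add]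
  · refine norm_integral_le_of_norm_le ?_ ?_
    · exact ((hi.norm.const_mul a).add ((hi.norm.indicator hm1).const_mul B)).add
        ((hi.norm.indicator hm2).const_mul B)
    · filter_upwards [hfar, hnear] with w h1 h2
      rw [← sub_smul, norm_smul, Real.norm_eq_abs]
      have hp := norm_nonneg (ψ w)
      have hap : 0 ≤ a * ‖ψ w‖ := by positivity
      have hBp : 0 ≤ B * ‖ψ w‖ := by positivity
      have hBw : |G w - H w| * ‖ψ w‖ ≤ B * ‖ψ w‖ := by gcongr
      simp only [Set.indicator, Set.mem_ofPred_eq]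
      split_ifs with c1 c2 c2
      · linarith
      · linarith
      · linarith
      · have := mul_le_mul_of_nonneg_right (h2 (not_le.1 c1) (not_le.1 c2)) hp
        linarith
  · exact (hi.norm.const_mul a).add ((hi.norm.indicator hm1).const_mul B)
  · exact (hi.norm.indicator hm2).const_mul B
  · exact hi.norm.const_mul a
  · exact (hi.norm.indicator hm1).const_mul B

lemma exists_approx_const_of_convex (hM0 : 0 ≤ M) (hM : ∀ x ∉ E, |F x| ≤ M)
    (hLip : ∀ u u', Disjoint (segment ℝ u u') E → ‖u' - u‖ ≤ 1 → |F u' - F u| ≤ A * ‖u' - u‖)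
    (hA : 0 ≤ A) {S : Set Plane} (hS : Convex ℝ S) (hSE : Disjoint S E) {d : ℝ} (hd : d ≤ 1)
    (hSd : ∀ x ∈ S, ∀ y ∈ S, ‖x - y‖ ≤ d) : ∃ c, |c| ≤ M ∧ ∀ x ∈ S, |F x - c| ≤ A * d := by
  rcases S.eq_empty_or_nonempty with rfl | ⟨y, hy⟩
  · exact ⟨0, by simpa using hM0, by simp⟩
  · refine ⟨F y, hM y (Set.disjoint_left.1 hSE hy), fun x hx => ?_⟩
    have h := hSd x hx y hy
    refine (hLip y x (hSE.mono_left (hS.segment_subset hy hx)) (h.trans hd)).trans ?_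
    gcongr

lemma integrable_bounded_smul (hi : Integrable ψ) {G : Plane → ℝ}
    (hG : AEStronglyMeasurable G) (hM : ∀ᵐ w, |G w| ≤ M) : Integrable fun w => G w • ψ w :=
  hi.bdd_smul M hG hM

/-- If no point of `E` is within `ρ` of `u`, `F` is replaced by a constant near `u`. -/
lemma norm_integral_le_of_far_from_edge (hi : Integrable ψ) (hψ0 : ∫ w, ψ w = 0)
    (h0 : volume E = 0) (hm : AEStronglyMeasurable F) (hM0 : 0 ≤ M) (hM : ∀ x ∉ E, |F x| ≤ M)
    (hA : 0 ≤ A)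
    (hLip : ∀ u u', Disjoint (segment ℝ u u') E → ‖u' - u‖ ≤ 1 → |F u' - F u| ≤ A * ‖u' - u‖)
    {ε ρ : ℝ} (hε : 0 < ε) (hρ : 0 < ρ) (hρ1 : 2 * ρ ≤ 1) {u : Plane}
    (hu : ∀ p ∈ E, ρ ≤ ‖p - u‖) (θ b : ℝ) :
    ‖∫ w, F (u - ε • w) • ψ w‖ ≤ A * (2 * ρ) * (∫ w, ‖ψ w‖) +
      2 * M * (∫ w in {w | ρ / ε ≤ ‖w‖}, ‖ψ w‖) +
      2 * M * (∫ w in {w | |normalCoord θ w - b| ≤ 0}, ‖ψ w‖) := by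
  have hq := quasiMeasurePreserving_sub_smul u hε
  have hae : ∀ᵐ w, |F (u - ε • w)| ≤ M :=
    hq.ae ((measure_eq_zero_iff_ae_notMem.1 h0).mono hM)
  obtain ⟨c, hc, hcF⟩ := exists_approx_const_of_convex (S := Metric.ball u ρ) hM0 hM hLip hA
    (convex_ball _ _)
    (Set.disjoint_left.2 fun x hx hxE => (hu x hxE).not_gt (mem_ball_iff_norm.1 hx)) hρ1
    (fun x hx y hy => by
      rw [← dist_eq_norm]
      exact (dist_triangle_right x y u).trans
        (by linarith [Metric.mem_ball.1 hx, Metric.mem_ball.1 hy]))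
  refine norm_integral_smul_le_of_approx (H := fun _ => c) hi (by positivity) (by positivity)
    (integrable_bounded_smul hi (hm.comp_quasiMeasurePreserving hq) hae) (hi.smul c)
    (by rw [integral_smul, hψ0, smul_zero]) ?_ ?_
  · filter_upwards [hae] with w hw
    exact (abs_sub _ _).trans (by linarith)
  · refine Filter.Eventually.of_forall fun w hw _ => hcF _ ?_
    rw [lt_div_iff₀ hε] at hw
    rw [mem_ball_iff_norm, sub_sub_cancel_left, norm_neg, norm_smul, Real.norm_of_nonneg hε.le]
    linarith

/-- If a point of `E` is within `ρ` of `u`, `F` is replaced near `u` by a function that is constant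
on either side of a tangent line. -/
lemma norm_integral_le_of_near_edge (hi : Integrable ψ)
    (hdir : HasDirectionalVanishingMoments 2 (Set.Icc (-(Real.pi / 4)) (Real.pi / 4)) ψ)
    (h0 : volume E = 0) (hm : AEStronglyMeasurable F) (hM0 : 0 ≤ M) (hM : ∀ x ∉ E, |F x| ≤ M)
    (hA : 0 ≤ A)
    (hLip : ∀ u u', Disjoint (segment ℝ u u') E → ‖u' - u‖ ≤ 1 → |F u' - F u| ≤ A * ‖u' - u‖)
    (hα : 0 ≤ α) (hK : 0 ≤ K) (hT : HasTangentLines α δ K E)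
    {ε ρ : ℝ} (hε : 0 < ε) (hρ1 : 4 * ρ ≤ 1) (hρδ : 2 * ρ ≤ δ) {u p : Plane}
    (hp : p ∈ E) (hu : ‖p - u‖ < ρ) :
    ∃ θ b, ‖∫ w, F (u - ε • w) • ψ w‖ ≤ A * (4 * ρ) * (∫ w, ‖ψ w‖) +
      2 * M * (∫ w in {w | ρ / ε ≤ ‖w‖}, ‖ψ w‖) +
      2 * M * (∫ w in {w | |normalCoord θ w - b| ≤ K * (2 * ρ) ^ α / ε}, ‖ψ w‖) := by
  have hρ : 0 < ρ := (norm_nonneg _).trans_lt hu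
  obtain ⟨θ, hθ, hE⟩ := hT p hp
  have hq := quasiMeasurePreserving_sub_smul u hε
  have hae : ∀ᵐ w, |F (u - ε • w)| ≤ M :=
    hq.ae ((measure_eq_zero_iff_ae_notMem.1 h0).mono hM)
  -- The ball about p of radius 2ρ contains the ball of radius ρ about u. Cut by the half-plane
  -- beyond the strip, it is convex and free of E, so F is nearly constant on it.
  have hside : ∀ σ : ℝ, |σ| = 1 → ∃ c, |c| ≤ M ∧ ∀ x ∈ Metric.ball p (2 * ρ),
      K * (2 * ρ) ^ α < σ * normalCoord θ (x - p) → |F x - c| ≤ A * (4 * ρ) := by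
    intro σ hσ
    obtain ⟨c, hc, h⟩ := exists_approx_const_of_convex (E := E) (d := 4 * ρ)
      (S := Metric.ball p (2 * ρ) ∩
        {x | K * (2 * ρ) ^ α + σ * normalCoord θ p < (σ • normalCoord θ) x}) hM0 hM hLip hA
      ((convex_ball _ _).inter (convex_halfSpace_gt (σ • normalCoord θ).isLinear _))
      (Set.disjoint_left.2 fun x ⟨hx, hx'⟩ hxE => by
        rw [mem_ball_iff_norm] at hx
        have h1 := hE x hxE (hx.trans_le hρδ)
        have h2 : K * ‖x - p‖ ^ α ≤ K * (2 * ρ) ^ α := by gcongr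
        have h3 : σ * normalCoord θ (x - p) ≤ |normalCoord θ (x - p)| := by
          refine (le_abs_self _).trans ?_
          rw [abs_mul, hσ, one_mul]
        simp only [Set.mem_ofPred_eq, LinearMap.smul_apply, smul_eq_mul] at hx'
        rw [map_sub, mul_sub] at h3
        rw [map_sub] at h1
        linarith) hρ1
      (fun x hx y hy => by
        rw [← dist_eq_norm]
        exact (dist_triangle_right x y p).trans
          (by linarith [Metric.mem_ball.1 hx.1, Metric.mem_ball.1 hy.1]))
    refine ⟨c, hc, fun x hx hx' => h x ⟨hx, ?_⟩⟩
    rw [map_sub, mul_sub] at hx'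
    simp only [Set.mem_ofPred_eq, LinearMap.smul_apply, smul_eq_mul]
    linarith
  obtain ⟨c₁, hc₁, h₁⟩ := hside 1 (by simp)
  obtain ⟨c₂, hc₂, h₂⟩ := hside (-1) (by simp)
  -- In the variable w the tangent line is `normalCoord θ w = b`. The minus sign in u - εw exchanges
  -- sides: the positive side corresponds to values below b.
  set b := normalCoord θ (u - p) / ε with hb
  have hn : ∀ w, normalCoord θ (u - ε • w - p) = ε * (b - normalCoord θ w) := by
    intro w
    rw [sub_right_comm, map_sub, map_smul, hb, smul_eq_mul]
    field_simp
  set g : ℝ → ℝ := fun y => if y < b then c₁ else c₂ with hg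
  have hgm : Measurable g := Measurable.ite measurableSet_Iio measurable_const measurable_const
  have hgM : ∀ y, |g y| ≤ M := fun y => by
    simp only [hg]; split_ifs <;> assumption
  refine ⟨θ, b, norm_integral_smul_le_of_approx (H := fun w => g (normalCoord θ w)) hi
    (by positivity) (by positivity)
    (integrable_bounded_smul hi (hm.comp_quasiMeasurePreserving hq) hae)
    (integrable_bounded_smul hi
      (hgm.comp (continuous_normalCoord θ).measurable).aestronglyMeasurable
      (Filter.Eventually.of_forall fun w => hgM _))
    (hdir.integral_smul_eq_zero two_pos hθ g) ?_ ?_⟩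
  · filter_upwards [hae] with w hw
    exact (abs_sub _ _).trans (by linarith [hgM (normalCoord θ w)])
  · refine Filter.Eventually.of_forall fun w hw hs => ?_
    have hx : u - ε • w ∈ Metric.ball p (2 * ρ) := by
      rw [lt_div_iff₀ hε] at hw
      rw [mem_ball_iff_norm, sub_right_comm]
      refine (norm_sub_le _ _).trans_lt ?_
      rw [norm_smul, Real.norm_of_nonneg hε.le, norm_sub_rev]
      linarith
    rw [div_lt_iff₀ hε] at hs
    simp only [hg]
    split_ifs with hw'
    · refine h₁ _ hx ?_
      rw [abs_of_neg (by linarith)] at hs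
      rw [hn]
      linarith
    · refine h₂ _ hx ?_
      rw [abs_of_nonneg (by linarith)] at hs
      rw [hn]
      linarith

lemma exists_bound_integral_edge (hc : Continuous ψ) (hdec : HasRapidDecay ψ)
    (hmom : HasVanishingMoments 2 ψ)
    (hdir : HasDirectionalVanishingMoments 2 (Set.Icc (-(Real.pi / 4)) (Real.pi / 4)) ψ)
    (h0 : volume E = 0) (hm : AEStronglyMeasurable F) (hM0 : 0 ≤ M) (hM : ∀ x ∉ E, |F x| ≤ M)
    (hA : 0 ≤ A)
    (hLip : ∀ u u', Disjoint (segment ℝ u u') E → ‖u' - u‖ ≤ 1 → |F u' - F u| ≤ A * ‖u' - u‖)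
    (hα : 0 ≤ α) (hK : 0 ≤ K) (hδ : 0 < δ) (hT : HasTangentLines α δ K E) (N : ℕ) :
    ∃ C, 0 ≤ C ∧ ∀ ε ρ : ℝ, 0 < ε → 0 < ρ → ∀ u,
      ‖∫ w, F (u - ε • w) • ψ w‖ ≤ C * (ρ + (ρ / ε) ^ (-(N : ℝ)) + ρ ^ α / ε) := by
  have hi := hdec.integrable hc
  obtain ⟨C₁, hC₁, hfar⟩ := hdec.setIntegral_norm_ge_le hc N
  obtain ⟨C₂, hC₂, hstrip⟩ := hdec.setIntegral_strip_le
  have hI : 0 ≤ ∫ w, ‖ψ w‖ := by positivity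
  set I := ∫ w, ‖ψ w‖
  set δ' := min δ 1 / 4 with hδ'
  have hδ'0 : 0 < δ' := by positivity
  set D₁ := A * 4 * I with hD₁
  set D₂ := 2 * M * C₁ with hD₂
  set D₃ := 2 * M * C₂ * K * 2 ^ α with hD₃
  set D₄ := M * I / δ' with hD₄
  have p₁ : 0 ≤ D₁ := by positivity
  have p₂ : 0 ≤ D₂ := by positivity
  have p₃ : 0 ≤ D₃ := by positivity
  have p₄ : 0 ≤ D₄ := by positivity
  refine ⟨D₁ + D₂ + D₃ + D₄, by positivity, fun ε ρ hε hρ u => ?_⟩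
  set X := (ρ / ε) ^ (-(N : ℝ)) with hX
  set Y := ρ ^ α / ε with hY
  have hX0 : 0 ≤ X := by positivity
  have hY0 : 0 ≤ Y := by positivity
  have hsum : ∀ t, t ≤ D₄ * ρ ∨ t ≤ D₁ * ρ + D₂ * X + D₃ * Y →
      t ≤ (D₁ + D₂ + D₃ + D₄) * (ρ + X + Y) := by
    intro t ht
    have a₁ := mul_nonneg p₁ hρ.le
    have a₂ := mul_nonneg p₂ hρ.le
    have a₃ := mul_nonneg p₃ hρ.le
    have a₄ := mul_nonneg p₄ hρ.le
    have b₁ := mul_nonneg p₁ hX0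
    have b₂ := mul_nonneg p₂ hX0
    have b₃ := mul_nonneg p₃ hX0
    have b₄ := mul_nonneg p₄ hX0
    have c₁ := mul_nonneg p₁ hY0
    have c₂ := mul_nonneg p₂ hY0
    have c₃ := mul_nonneg p₃ hY0
    have c₄ := mul_nonneg p₄ hY0
    rcases ht with h | h <;> linarith
  refine hsum _ ?_
  have htail := mul_le_mul_of_nonneg_left (hfar (ρ / ε) (by positivity))
    (by positivity : 0 ≤ 2 * M)
  rw [← hX] at htail
  -- For ρ ≥ δ' localization is impossible, but the trivial bound M·I is already at most D₄ρ.
  rcases le_or_gt δ' ρ with hρ' | hρ'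
  · left
    have hae : ∀ᵐ w, ‖F (u - ε • w) • ψ w‖ ≤ M * ‖ψ w‖ := by
      filter_upwards [(quasiMeasurePreserving_sub_smul u hε).ae
        ((measure_eq_zero_iff_ae_notMem.1 h0).mono hM)] with w hw
      rw [norm_smul]
      gcongr
      exact hw
    refine (norm_integral_le_of_norm_le (hi.norm.const_mul M) hae).trans ?_
    rw [integral_const_mul, hD₄, div_mul_eq_mul_div, le_div_iff₀ hδ'0]
    gcongr
  · right
    have h1 : 4 * ρ ≤ 1 := by linarith [min_le_right δ 1]
    have h2 : 4 * ρ ≤ δ := by linarith [min_le_left δ 1]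
    by_cases hu : ∃ p ∈ E, ‖p - u‖ < ρ
    · obtain ⟨p, hp, hpu⟩ := hu
      obtain ⟨θ, b, h⟩ := norm_integral_le_of_near_edge hi hdir h0 hm hM0 hM hA hLip hα hK hT hε h1
        (by linarith) hp hpu
      have hs := mul_le_mul_of_nonneg_left
        (hstrip θ b (K * (2 * ρ) ^ α / ε) (by positivity)) (by positivity : 0 ≤ 2 * M)
      have e : 2 * M * (C₂ * (K * (2 * ρ) ^ α / ε)) = D₃ * Y := by
        rw [Real.mul_rpow (by norm_num) hρ.le]; ring
      rw [e] at hs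
      linarith
    · push Not at hu
      have h := norm_integral_le_of_far_from_edge hi (hmom.integral_eq_zero two_pos) h0 hm hM0 hM
        hA hLip hε hρ (by linarith) hu 0 0
      -- Away from the edge the strip is a dummy of width zero.
      have hs := mul_le_mul_of_nonneg_left (hstrip 0 0 0 le_rfl) (by positivity : 0 ≤ 2 * M)
      have : 0 ≤ D₃ * Y := by positivity
      have := mul_nonneg p₁ hρ.le
      linarith

end

/-! ### Geometry of Lipschitz curves with nearly horizontal tangents. -/

section Curve

variable {α L : ℝ} {c : ℝ → Plane}

lemma exists_affine_of_natDegree_lt (hα : 0 < α) (hα2 : α ≤ 2) (hc : UniformlyLipschitzCurve α L c)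
    (t : ℝ) (i : Fin 2) : ∃ b : ℝ, (α = 1 → b = 0) ∧
      ∀ t', |c t' i - c t i - (t' - t) * b| ≤ L * |t' - t| ^ α := by
  obtain ⟨q, hq, h⟩ := hc i t
  have hd : q.natDegree ≤ 1 := by
    have : (q.natDegree : ℝ) < 2 := hq.trans_le hα2
    have : q.natDegree < 2 := by exact_mod_cast this
    omega
  have he : ∀ s, q.eval s = q.coeff 1 * s + q.coeff 0 := fun s => by
    conv_lhs => rw [Polynomial.eq_X_add_C_of_natDegree_le_one hd]
    simp
  have h0 : c t i = q.eval t := by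
    have := h t
    rw [sub_self, abs_zero, Real.zero_rpow hα.ne', mul_zero] at this
    linarith [abs_eq_zero.1 (le_antisymm this (abs_nonneg _))]
  refine ⟨q.coeff 1, fun h1 => ?_, fun t' => ?_⟩
  · refine Polynomial.coeff_eq_zero_of_natDegree_lt ?_
    rw [h1] at hq
    exact_mod_cast hq
  · have := h t'
    rw [abs_sub_comm t t'] at this
    convert this using 2
    rw [h0, he, he]
    ring

/-- A curve has first-order expansions with a remainder of order `α`. -/
def HasCurveExpansions (α L : ℝ) (c : ℝ → Plane) : Prop :=
  ∀ t, DifferentiableAt ℝ c t ∧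
    ∀ t', ‖c t' - c t - (t' - t) • deriv c t‖ ≤ L * |t' - t| ^ α

/-- For α > 1 the remainder is o(|t' - t|), so the linear coefficients are forced to be the
derivative. -/
lemma UniformlyLipschitzCurve.hasCurveExpansions (hα : 1 < α) (hα2 : α ≤ 2)
    (hc : UniformlyLipschitzCurve α L c) : HasCurveExpansions α (2 * L) c := by
  intro t
  choose b _ hb using exists_affine_of_natDegree_lt (by linarith) hα2 hc t
  have key : ∀ t', ‖c t' - c t - (t' - t) • !₂[b 0, b 1]‖ ≤ 2 * L * |t' - t| ^ α := by
    intro t'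
    refine (norm_le_abs_add_abs _).trans ?_
    have h0 := hb 0 t'
    have h1 := hb 1 t'
    simp only [PiLp.sub_apply, PiLp.smul_apply, smul_eq_mul, Matrix.cons_val_zero,
      Matrix.cons_val_one]
    linarith
  have hder : HasDerivAt c !₂[b 0, b 1] t := by
    rw [hasDerivAt_iff_isLittleO, Asymptotics.isLittleO_iff]
    intro ε hε
    have hcont : Continuous fun t' : ℝ => 2 * L * |t' - t| ^ (α - 1) :=
      continuous_const.mul
        ((by fun_prop : Continuous fun t' : ℝ => |t' - t|).rpow_const
          fun _ => Or.inr (by linarith))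
    have hlim := hcont.tendsto t
    rw [sub_self, abs_zero, Real.zero_rpow (by linarith), mul_zero] at hlim
    filter_upwards [hlim.eventually (gt_mem_nhds hε)] with t' ht'
    refine (key t').trans ?_
    have e : |t' - t| ^ α = |t' - t| ^ (α - 1) * |t' - t| := by
      rw [← Real.rpow_add_one' (abs_nonneg _) (by linarith), sub_add_cancel]
    rw [e, ← mul_assoc, Real.norm_eq_abs]
    gcongr
  exact ⟨hder.differentiableAt, fun t' => by rw [hder.deriv]; exact key t'⟩

lemma norm_cos_sin (θ : ℝ) : ‖(!₂[Real.cos θ, Real.sin θ] : Plane)‖ = 1 := by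
  simp [EuclideanSpace.norm_eq]

/-- At α = 1 the polynomials are constants and the definition is a Lipschitz bound; for α > 1 the
curve is differentiable and its speed is bounded. -/
lemma UniformlyLipschitzCurve.exists_lipschitzWith (hα : 1 ≤ α) (hα2 : α ≤ 2)
    (hc : UniformlyLipschitzCurve α L c)
    (hunit : ∀ t, DifferentiableAt ℝ c t → ‖deriv c t‖ ≤ 1) : ∃ K, LipschitzWith K c := by
  rcases hα.eq_or_lt with rfl | hα
  · refine ⟨_, LipschitzWith.of_dist_le' (K := 2 * L) fun s t => ?_⟩
    rw [dist_comm, dist_comm s t, dist_eq_norm, dist_eq_norm, Real.norm_eq_abs]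
    refine (norm_le_abs_add_abs _).trans ?_
    obtain ⟨b, hb, h⟩ := exists_affine_of_natDegree_lt (by linarith) hα2 hc s 0
    obtain ⟨b', hb', h'⟩ := exists_affine_of_natDegree_lt (by linarith) hα2 hc s 1
    have h1 := h t
    have h1' := h' t
    rw [hb rfl, mul_zero, sub_zero, Real.rpow_one] at h1
    rw [hb' rfl, mul_zero, sub_zero, Real.rpow_one] at h1'
    simp only [PiLp.sub_apply]
    linarith
  · have hd := hc.hasCurveExpansions hα hα2
    refine ⟨1, lipschitzWith_of_nnnorm_deriv_le (fun t => (hd t).1) fun t => ?_⟩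
    exact_mod_cast hunit t (hd t).1

/-- A Lipschitz function is absolutely continuous, hence the integral of its almost everywhere
derivative. This covers α = 1, where tangents may be missing on a null set. -/
lemma LipschitzWith.le_apply_sub_of_le_deriv {K : NNReal} (hc : LipschitzWith K c)
    (a : Plane →L[ℝ] ℝ) {m : ℝ} (hm : ∀ t, DifferentiableAt ℝ c t → m ≤ a (deriv c t))
    {t t' : ℝ} (h : t ≤ t') : m * (t' - t) ≤ a (c t' - c t) := by
  have hac : AbsolutelyContinuousOnInterval (fun s => a (c s)) t t' :=
    ((a.lipschitz.comp hc).lipschitzOnWith).absolutelyContinuousOnInterval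
  rw [map_sub, ← hac.integral_deriv_eq_sub]
  have hconst : m * (t' - t) = ∫ _ in t..t', m := by simp [mul_comm]
  rw [hconst]
  refine intervalIntegral.integral_mono_ae h (by simp) hac.intervalIntegrable_deriv ?_
  filter_upwards [hc.ae_differentiableAt_real] with s hs
  have : deriv (fun s => a (c s)) s = a (deriv c s) :=
    (a.hasFDerivAt.comp_hasDerivAt s hs.hasDerivAt).deriv
  rw [this]
  exact hm s hs

/-- Every tangent of the curve has an angle in `[-π/4, π/4]`. -/
def HasHorizontalTangents (d : ℝ → Plane) : Prop :=
  ∀ t, DifferentiableAt ℝ d t → ∃ θ ∈ Set.Icc (-(Real.pi / 4)) (Real.pi / 4),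
    deriv d t = !₂[Real.cos θ, Real.sin θ]

lemma abs_sin_le_cos {θ : ℝ} (hθ : θ ∈ Set.Icc (-(Real.pi / 4)) (Real.pi / 4)) :
    |Real.sin θ| ≤ Real.cos θ := by
  have hpi := Real.pi_pos
  have h1 : 0 ≤ Real.cos (2 * θ) :=
    Real.cos_nonneg_of_neg_pi_div_two_le_of_le (by linarith [hθ.1]) (by linarith [hθ.2])
  have h2 : 0 ≤ Real.cos θ :=
    Real.cos_nonneg_of_neg_pi_div_two_le_of_le (by linarith [hθ.1]) (by linarith [hθ.2])
  rw [Real.cos_two_mul'] at h1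
  exact abs_le_of_sq_le_sq (by linarith) h2

lemma half_le_cos {θ : ℝ} (hθ : θ ∈ Set.Icc (-(Real.pi / 4)) (Real.pi / 4)) :
    1 / 2 ≤ Real.cos θ := by
  have h := abs_sin_le_cos hθ
  have h1 := Real.sin_sq_add_cos_sq θ
  have h2 : (Real.sin θ) ^ 2 ≤ Real.cos θ ^ 2 := by
    rw [← sq_abs]; gcongr
  nlinarith [abs_nonneg (Real.sin θ)]

/-- The linear form with the given coefficients. -/
def coordForm (p q : ℝ) : Plane →L[ℝ] ℝ :=
  p • EuclideanSpace.proj 0 + q • EuclideanSpace.proj 1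

@[simp] lemma coordForm_apply (p q : ℝ) (v : Plane) : coordForm p q v = p * v 0 + q * v 1 := by
  simp [coordForm]

variable {d : ℝ → Plane}

/-- Both x + y and x - y are nondecreasing along the curve, because |sin θ| ≤ cos θ. -/
lemma HasHorizontalTangents.abs_sub_le {K : NNReal} (h : HasHorizontalTangents d)
    (hd : LipschitzWith K d) (t t' : ℝ) : |d t' 1 - d t 1| ≤ |d t' 0 - d t 0| := by
  wlog htt : t ≤ t' generalizing t t'
  · rw [abs_sub_comm, abs_sub_comm (d t' 0)]
    exact this t' t (le_of_not_ge htt)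
  have h1 := hd.le_apply_sub_of_le_deriv (coordForm 1 1) (m := 0) (fun s hs => by
    obtain ⟨θ, hθ, e⟩ := h s hs
    have := abs_le.1 (abs_sin_le_cos hθ)
    rw [e]; simp; linarith) htt
  have h2 := hd.le_apply_sub_of_le_deriv (coordForm 1 (-1)) (m := 0) (fun s hs => by
    obtain ⟨θ, hθ, e⟩ := h s hs
    have := abs_le.1 (abs_sin_le_cos hθ)
    rw [e]; simp; linarith) htt
  simp only [zero_mul, coordForm_apply, PiLp.sub_apply] at h1 h2
  refine (abs_le.2 ⟨?_, ?_⟩).trans (le_abs_self _) <;> linarith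

/-- The first coordinate grows at speed at least 1/2. This turns remainders in the parameter into
remainders in the distance. -/
lemma HasHorizontalTangents.abs_sub_param_le {K : NNReal} (h : HasHorizontalTangents d)
    (hd : LipschitzWith K d) (t t' : ℝ) : |t' - t| ≤ 2 * ‖d t' - d t‖ := by
  wlog htt : t ≤ t' generalizing t t'
  · rw [abs_sub_comm, norm_sub_rev]
    exact this t' t (le_of_not_ge htt)
  have h1 := hd.le_apply_sub_of_le_deriv (coordForm 1 0) (m := 1 / 2) (fun s hs => by
    obtain ⟨θ, hθ, e⟩ := h s hs
    rw [e]; simpa using half_le_cos hθ) htt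
  have h2 := (le_abs_self _).trans (abs_coord_le_norm (d t' - d t) 0)
  rw [coordForm_apply] at h1
  rw [abs_of_nonneg (by linarith)]
  linarith

/-- The normal coordinate kills the tangent vector, so only the remainder of the expansion survives.
-/
lemma HasCurveExpansions.abs_normalCoord_le {K : NNReal} (hL : 0 ≤ L) (hα : 0 ≤ α)
    (he : HasCurveExpansions α L d) (h : HasHorizontalTangents d) (hd : LipschitzWith K d) (t : ℝ) :
    ∃ θ ∈ Set.Icc (-(Real.pi / 4)) (Real.pi / 4), ∀ t',
      |normalCoord θ (d t' - d t)| ≤ 2 * L * 2 ^ α * ‖d t' - d t‖ ^ α := by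
  obtain ⟨hdiff, hexp⟩ := he t
  obtain ⟨θ, hθ, e⟩ := h t hdiff
  refine ⟨θ, hθ, fun t' => ?_⟩
  have h1 : normalCoord θ (d t' - d t) = normalCoord θ (d t' - d t - (t' - t) • deriv d t) := by
    rw [map_sub _ (d t' - d t), map_smul, e]
    simp [normalCoord_apply]
    ring
  have h2 : ∀ v, |normalCoord θ v| ≤ 2 * ‖v‖ := by
    intro v
    rw [normalCoord_apply]
    refine (abs_add_le _ _).trans ?_
    rw [abs_mul, abs_mul, abs_neg]
    nlinarith [Real.abs_sin_le_one θ, Real.abs_cos_le_one θ, abs_coord_le_norm v 0,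
      abs_coord_le_norm v 1, abs_nonneg (v 0), abs_nonneg (v 1)]
  rw [h1]
  refine (h2 _).trans ?_
  have h3 : |t' - t| ^ α ≤ 2 ^ α * ‖d t' - d t‖ ^ α := by
    rw [← Real.mul_rpow (by norm_num) (norm_nonneg _)]
    gcongr
    exact h.abs_sub_param_le hd t t'
  have h4 := mul_le_mul_of_nonneg_left h3 hL
  linarith [hexp t']

end Curve

/-! ### The integer lattice, the lifts of the edge, and regularity along segments. -/

@[simp] lemma latticePoint_apply (n : Fin 2 → ℤ) (i : Fin 2) : latticePoint n i = n i := by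
  fin_cases i <;> rfl

lemma latticePoint_add (n m : Fin 2 → ℤ) :
    latticePoint (n + m) = latticePoint n + latticePoint m := by
  ext i; simp

lemma latticePoint_neg (n : Fin 2 → ℤ) : latticePoint (-n) = -latticePoint n := by
  ext i; simp

lemma latticePoint_sub (n m : Fin 2 → ℤ) :
    latticePoint (n - m) = latticePoint n - latticePoint m := by
  ext i; simp

@[simp] lemma latticePoint_zero : latticePoint 0 = 0 := by
  ext i; simp

lemma one_le_dist_latticePoint {n m : Fin 2 → ℤ} (h : n ≠ m) :
    1 ≤ dist (latticePoint n) (latticePoint m) := by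
  obtain ⟨i, hi⟩ := Function.ne_iff.1 h
  rw [dist_eq_norm]
  refine le_trans ?_ (abs_coord_le_norm _ i)
  have : 1 ≤ |n i - m i| := Int.one_le_abs (sub_ne_zero.2 hi)
  simpa using (by exact_mod_cast this : (1 : ℝ) ≤ |(n i : ℝ) - m i|)

lemma latticePoint_injective : Function.Injective latticePoint := by
  intro n m h
  by_contra hne
  have := one_le_dist_latticePoint hne
  rw [h, dist_self] at this
  linarith

lemma isClosed_image_latticePoint (s : Set (Fin 2 → ℤ)) : IsClosed (latticePoint '' s) := by
  refine Metric.isClosed_of_pairwise_le_dist one_pos ?_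
  rintro _ ⟨n, -, rfl⟩ _ ⟨m, -, rfl⟩ h
  exact one_le_dist_latticePoint fun e => h (by rw [e])

section Edge

variable {α ℓ : ℝ} {k : ℕ} {c : ℝ → Plane}

lemma add_latticePoint_mem_edgeSet {x : Plane} (n : Fin 2 → ℤ) :
    x + latticePoint n ∈ edgeSet c ↔ x ∈ edgeSet c := by
  have : ∀ (x : Plane) n, x ∈ edgeSet c → x + latticePoint n ∈ edgeSet c := by
    rintro _ n ⟨t, m, rfl⟩
    exact ⟨t, m + n, by rw [latticePoint_add, add_assoc]⟩
  refine ⟨fun h => ?_, this x n⟩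
  simpa [latticePoint_neg] using this _ (-n) h

lemma apply_add_zsmul_of_closed {m : Fin 2 → ℤ}
    (hm : ∀ t, c (t + ℓ) = c t + latticePoint m) (i : ℤ) (t : ℝ) :
    c (t + i * ℓ) = c t + latticePoint (i • m) := by
  induction i using Int.induction_on with
  | zero => simp
  | succ i ih =>
    have : t + ((i : ℤ) + 1 : ℤ) * ℓ = t + (i : ℤ) * ℓ + ℓ := by push_cast; ring
    rw [this, hm, ih, add_smul, one_smul, latticePoint_add, add_assoc]
  | pred i ih =>
    have : t + (-(i : ℤ)  : ℤ) * ℓ = t + (-(i : ℤ) - 1 : ℤ) * ℓ + ℓ := by push_cast; ring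
    rw [this, hm] at ih
    rw [sub_smul, one_smul, latticePoint_sub, ← add_sub_assoc, ← ih, add_sub_cancel_right]

lemma IsEdgeCurve.exists_mem_Icc (hc : IsEdgeCurve α k ℓ c) {x : Plane} (hx : x ∈ edgeSet c) :
    ∃ t ∈ Set.Icc 0 ℓ, ∃ n, x = c t + latticePoint n := by
  obtain ⟨t, n, rfl⟩ := hx
  obtain ⟨m, hm⟩ := hc.closed
  obtain ⟨i, hi, -⟩ := existsUnique_add_zsmul_mem_Ico hc.length_pos t 0
  rw [zero_add, zsmul_eq_mul] at hi
  refine ⟨t + i * ℓ, ⟨hi.1, hi.2.le⟩, n - i • m, ?_⟩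
  rw [apply_add_zsmul_of_closed hm, latticePoint_sub]
  abel

open scoped Pointwise in
lemma IsEdgeCurve.isClosed_edgeSet (hc : IsEdgeCurve α k ℓ c) (hcont : Continuous c) :
    IsClosed (edgeSet c) := by
  have : edgeSet c = c '' Set.Icc 0 ℓ + latticePoint '' Set.univ := by
    ext x
    rw [Set.mem_add]
    constructor
    · intro hx
      obtain ⟨t, ht, n, rfl⟩ := hc.exists_mem_Icc hx
      exact ⟨_, ⟨t, ht, rfl⟩, _, ⟨n, trivial, rfl⟩, rfl⟩
    · rintro ⟨_, ⟨t, -, rfl⟩, _, ⟨n, -, rfl⟩, rfl⟩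
      exact ⟨t, n, rfl⟩
  rw [this]
  exact (isClosed_image_latticePoint _).add_left_of_isCompact (isCompact_Icc.image hcont)

/-- Points over the edge that are close to one another lie on the same lift of it. -/
lemma IsEdgeCurve.exists_same_lift (hc : IsEdgeCurve α k ℓ c) (hcont : Continuous c) :
    ∃ δ > 0, ∀ t n, ∀ y ∈ edgeSet c, ‖y - (c t + latticePoint n)‖ < δ →
      ∃ t', y = c t' + latticePoint n := by
  obtain ⟨m, hm⟩ := hc.closed
  -- Differences of points of one period form a compact set. Lattice points that are not multiples
  -- of the period m form a closed set, disjoint from it because the curve is simple. The positive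
  -- distance between the two is δ.
  have hK : IsCompact ((fun z : ℝ × ℝ => c z.2 - c z.1) '' (Set.Icc 0 ℓ ×ˢ Set.Icc 0 ℓ)) :=
    (isCompact_Icc.prod isCompact_Icc).image (by fun_prop)
  have hS := isClosed_image_latticePoint {n | ¬ ∃ i : ℤ, n = i • m}
  obtain ⟨r, hr, h⟩ := Metric.exists_pos_forall_lt_edist hK hS <| by
    rw [Set.disjoint_left]
    rintro _ ⟨⟨t, t'⟩, -, rfl⟩ ⟨n, hn, e⟩
    have e' : c t' = c t + latticePoint n := by rw [e]; simp
    obtain ⟨i, rfl⟩ := hc.simple t t' n e'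
    rw [apply_add_zsmul_of_closed hm] at e'
    exact hn ⟨i, (latticePoint_injective (add_left_cancel e')).symm⟩
  refine ⟨r, hr, fun t n y hy hxy => ?_⟩
  obtain ⟨i, hi, -⟩ := existsUnique_add_zsmul_mem_Ico hc.length_pos t 0
  rw [zero_add, zsmul_eq_mul] at hi
  obtain ⟨t', ht', n', rfl⟩ := hc.exists_mem_Icc hy
  by_cases hn : ∃ l : ℤ, n - i • m - n' = l • m
  · obtain ⟨l, hl⟩ := hn
    refine ⟨t' + (-(i + l) : ℤ) * ℓ, ?_⟩
    have e : n' = (-(i + l)) • m + n := by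
      rw [neg_smul, add_smul, ← hl]; abel
    rw [apply_add_zsmul_of_closed hm, add_assoc, ← latticePoint_add, ← e]
  · have h1 := h (c t' - c (t + i * ℓ)) ⟨(t + i * ℓ, t'), ⟨⟨hi.1, hi.2.le⟩, ht'⟩, rfl⟩
      (latticePoint (n - i • m - n')) ⟨_, hn, rfl⟩
    rw [edist_dist, dist_eq_norm, ← ENNReal.ofReal_coe_nnreal,
      ENNReal.ofReal_lt_ofReal_iff_of_nonneg r.coe_nonneg] at h1
    have e : c t' - c (t + i * ℓ) - latticePoint (n - i • m - n') =
        c t' + latticePoint n' - (c t + latticePoint n) := by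
      rw [apply_add_zsmul_of_closed hm, latticePoint_sub, latticePoint_sub]; abel
    rw [e] at h1
    exact absurd hxy h1.not_gt

lemma exists_norm_le_of_periodic {f : Plane → ℝ} (hf : IsPeriodicImage f) {x : Plane}
    (hx : x ∉ edgeSet c) : ∃ y ∉ edgeSet c, ‖y‖ ≤ 2 ∧ f y = f x := by
  refine ⟨x + latticePoint (fun i => -⌊x i⌋), ?_, ?_, hf _ _⟩
  · rwa [add_latticePoint_mem_edgeSet]
  · refine (norm_le_abs_add_abs _).trans ?_
    have h : ∀ i, |(x + latticePoint (fun i => -⌊x i⌋)) i| ≤ 1 := by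
      intro i
      rw [PiLp.add_apply, latticePoint_apply, Int.cast_neg, ← sub_eq_add_neg]
      rw [Int.self_sub_floor, abs_of_nonneg (Int.fract_nonneg _)]
      exact (Int.fract_lt_one _).le
    linarith [h 0, h 1]

lemma MvPolynomial.exists_linearMap_of_totalDegree_le_one (q : MvPolynomial (Fin 2) ℝ)
    (hq : q.totalDegree ≤ 1) : ∃ a : Plane →ₗ[ℝ] ℝ, ∀ u u' : Plane,
      MvPolynomial.eval (fun i => u' i) q - MvPolynomial.eval (fun i => u i) q = a (u' - u) := by
  refine ⟨∑ e ∈ q.support, q.coeff e • (coordForm (e 0) (e 1) : Plane →ₗ[ℝ] ℝ), fun u u' => ?_⟩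
  simp only [MvPolynomial.eval_eq', ← Finset.sum_sub_distrib, LinearMap.sum_apply,
    LinearMap.smul_apply, smul_eq_mul, ← mul_sub]
  refine Finset.sum_congr rfl fun e he => ?_
  congr 1
  have h : e 0 + e 1 ≤ 1 := by
    have := (MvPolynomial.le_totalDegree he).trans hq
    rwa [Finsupp.sum_fintype _ _ (fun _ => rfl), Fin.sum_univ_two] at this
  have cases : (e 0 = 0 ∧ e 1 = 0) ∨ (e 0 = 1 ∧ e 1 = 0) ∨ (e 0 = 0 ∧ e 1 = 1) := by omega
  rw [Fin.prod_univ_two, Fin.prod_univ_two]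
  rcases cases with ⟨h0, h1⟩ | ⟨h0, h1⟩ | ⟨h0, h1⟩ <;> simp [h0, h1]

/-- A segment from u avoiding the edge stays in the component of u. Taking u' = u shows that q takes
the value f u at u, so only its linear part remains. -/
lemma IsRegularAwayFromEdge.exists_isSegmentRegular {f : Plane → ℝ} (hα : 0 < α) (hα2 : α ≤ 2)
    (hf : IsRegularAwayFromEdge α c f) : ∃ L, 0 ≤ L ∧ IsSegmentRegular α L (edgeSet c) f := by
  obtain ⟨L, hL⟩ := hf
  refine ⟨|L|, abs_nonneg _, fun u hu => ?_⟩
  obtain ⟨q, hq, h⟩ := hL u hu u (mem_connectedComponentIn hu)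
  have hq1 : q.totalDegree ≤ 1 := by
    have : (q.totalDegree : ℝ) < 2 := hq.trans_le hα2
    have : q.totalDegree < 2 := by exact_mod_cast this
    omega
  obtain ⟨a, ha⟩ := q.exists_linearMap_of_totalDegree_le_one hq1
  refine ⟨a, fun u' hu' => ?_⟩
  have hmem : u' ∈ connectedComponentIn (edgeSet c)ᶜ u :=
    (convex_segment u u').isPreconnected.subset_connectedComponentIn (left_mem_segment ℝ u u')
      (Set.subset_compl_iff_disjoint_right.2 hu') (right_mem_segment ℝ u u')
  have h1 := h u (mem_connectedComponentIn hu)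
  rw [sub_self, norm_zero, Real.zero_rpow hα.ne', mul_zero] at h1
  have h2 := abs_eq_zero.1 (le_antisymm h1 (abs_nonneg _))
  have h3 := h u' hmem
  rw [norm_sub_rev] at h3
  rw [← ha]
  have e : f u' - f u - (MvPolynomial.eval (fun i => u' i) q - MvPolynomial.eval (fun i => u i) q)
      = f u' - MvPolynomial.eval (fun i => u' i) q := by linarith
  rw [e]
  exact h3.trans (by gcongr; exact le_abs_self L)

lemma IsSegmentRegular.comp_planeRot {L : ℝ} {E : Set Plane} {f : Plane → ℝ}
    (hf : IsSegmentRegular α L E f) (φ : ℝ) :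
    IsSegmentRegular α L (planeRot φ ⁻¹' E) (fun x => f (planeRot φ x)) := by
  intro u hu
  obtain ⟨a, ha⟩ := hf _ hu
  refine ⟨a.comp (planeRotEquiv φ).toLinearEquiv.toLinearMap, fun u' hu' => ?_⟩
  have hs : segment ℝ (planeRot φ u) (planeRot φ u') = planeRot φ '' segment ℝ u u' :=
    (image_segment ℝ (planeRotEquiv φ).toLinearEquiv.toLinearMap.toAffineMap u u').symm
  have h := ha (planeRot φ u') (by
    rw [hs, Set.disjoint_left]
    rintro _ ⟨x, hx, rfl⟩ hxE
    exact Set.disjoint_left.1 hu' hx hxE)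
  have e : planeRot φ u' - planeRot φ u = planeRotEquiv φ (u' - u) := by
    rw [map_sub]; rfl
  rw [e, (planeRotEquiv φ).norm_map] at h
  exact h

end Edge

/-! ### The edge in the rotated frame. -/

section Rotated

variable {α ℓ : ℝ} {k : ℕ} {c : ℝ → Plane}

lemma planeRot_neg_cos_sin (φ θ : ℝ) :
    planeRot (-φ) !₂[Real.cos θ, Real.sin θ] = !₂[Real.cos (θ - φ), Real.sin (θ - φ)] := by
  ext i
  fin_cases i <;> simp [planeRot, Real.cos_sub, Real.sin_sub] <;> ring

lemma planeRot_neg_planeRot (φ : ℝ) (u : Plane) : planeRot (-φ) (planeRot φ u) = u :=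
  (planeRotEquiv φ).symm_apply_apply u

lemma planeRot_planeRot_neg (φ : ℝ) (u : Plane) : planeRot φ (planeRot (-φ) u) = u :=
  (planeRotEquiv φ).apply_symm_apply u

lemma planeRot_sub (φ : ℝ) (u v : Plane) : planeRot φ (u - v) = planeRot φ u - planeRot φ v :=
  map_sub (planeRotEquiv φ) u v

lemma planeRot_smul (φ a : ℝ) (u : Plane) : planeRot φ (a • u) = a • planeRot φ u :=
  map_smul (planeRotEquiv φ) a u

lemma norm_planeRot (φ : ℝ) (u : Plane) : ‖planeRot φ u‖ = ‖u‖ :=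
  (planeRotEquiv φ).norm_map u

lemma hasDerivAt_planeRot_comp {φ t : ℝ} {v : Plane} (h : HasDerivAt c v t) :
    HasDerivAt (fun t => planeRot φ (c t)) (planeRot φ v) t :=
  (planeRotEquiv φ).toContinuousLinearEquiv.toContinuousLinearMap.hasFDerivAt.comp_hasDerivAt t h

lemma IsEdgeCurve.norm_deriv_le (hc : IsEdgeCurve α k ℓ c) (t : ℝ)
    (ht : DifferentiableAt ℝ c t) : ‖deriv c t‖ ≤ 1 := by
  obtain ⟨θ, -, e⟩ := hc.tangent t ht
  rw [e, norm_cos_sin]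

lemma IsEdgeCurve.hasHorizontalTangents (hc : IsEdgeCurve α k ℓ c) :
    HasHorizontalTangents fun t => planeRot (-(k * Real.pi / 4)) (c t) := by
  intro t ht
  have h1 := hasDerivAt_planeRot_comp (φ := k * Real.pi / 4) ht.hasDerivAt
  simp only [planeRot_planeRot_neg] at h1
  obtain ⟨θ, hθ, e⟩ := hc.tangent t h1.differentiableAt
  refine ⟨θ - k * Real.pi / 4, ⟨by linarith [hθ.1], by linarith [hθ.2]⟩, ?_⟩
  have h2 := hasDerivAt_planeRot_comp (φ := -(k * Real.pi / 4)) h1.differentiableAt.hasDerivAt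
  rw [h2.deriv, e, planeRot_neg_cos_sin]

lemma HasCurveExpansions.planeRot {L : ℝ} (h : HasCurveExpansions α L c) (φ : ℝ) :
    HasCurveExpansions α L fun t => planeRot φ (c t) := by
  intro t
  have hd := hasDerivAt_planeRot_comp (φ := φ) (h t).1.hasDerivAt
  refine ⟨hd.differentiableAt, fun t' => ?_⟩
  rw [hd.deriv, ← planeRot_smul, ← planeRot_sub, ← planeRot_sub, norm_planeRot]
  exact (h t).2 t'

/-- The edge in the frame rotated by the angle `kπ/4`. -/
def rotatedEdge (k : ℕ) (c : ℝ → Plane) : Set Plane := planeRot (k * Real.pi / 4) ⁻¹' edgeSet c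

lemma IsEdgeCurve.exists_lipschitzWith (hα : α ∈ Set.Icc (1 : ℝ) 2) (hc : IsEdgeCurve α k ℓ c) :
    ∃ K, LipschitzWith K c := by
  obtain ⟨L, hL⟩ := hc.lipschitz
  exact hL.exists_lipschitzWith hα.1 hα.2 hc.norm_deriv_le

lemma IsEdgeCurve.isClosed_rotatedEdge (hα : α ∈ Set.Icc (1 : ℝ) 2) (hc : IsEdgeCurve α k ℓ c) :
    IsClosed (rotatedEdge k c) := by
  obtain ⟨K, hK⟩ := hc.exists_lipschitzWith hα
  exact (hc.isClosed_edgeSet hK.continuous).preimage (planeRotEquiv _).continuous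

lemma IsEdgeCurve.exists_rotated_lift (hα : α ∈ Set.Icc (1 : ℝ) 2) (hc : IsEdgeCurve α k ℓ c) :
    ∃ δ > 0, ∀ x ∈ rotatedEdge k c, ∃ t, ∀ y ∈ rotatedEdge k c, ‖y - x‖ < δ →
      ∃ t', y - x = planeRot (-(k * Real.pi / 4)) (c t') - planeRot (-(k * Real.pi / 4)) (c t) := by
  obtain ⟨K, hK⟩ := hc.exists_lipschitzWith hα
  obtain ⟨δ, hδ, h⟩ := hc.exists_same_lift hK.continuous
  refine ⟨δ, hδ, fun x hx => ?_⟩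
  obtain ⟨t, n, hxt⟩ := hx
  refine ⟨t, fun y hy hxy => ?_⟩
  obtain ⟨t', hyt⟩ := h t n _ hy (by rwa [← hxt, ← planeRot_sub, norm_planeRot])
  refine ⟨t', ?_⟩
  rw [← planeRot_sub, ← add_sub_add_right_eq_sub (c t') (c t) (latticePoint n), ← hxt, ← hyt,
    ← planeRot_sub, planeRot_neg_planeRot]

lemma IsEdgeCurve.exists_hasLocalSlopeBound (hα : α ∈ Set.Icc (1 : ℝ) 2)
    (hc : IsEdgeCurve α k ℓ c) : ∃ δ > 0, HasLocalSlopeBound δ (rotatedEdge k c) := by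
  obtain ⟨K, hK⟩ := hc.exists_lipschitzWith hα
  obtain ⟨δ, hδ, h⟩ := hc.exists_rotated_lift hα
  refine ⟨δ, hδ, fun x hx y hy hxy => ?_⟩
  obtain ⟨t, ht⟩ := h x hx
  obtain ⟨t', ht'⟩ := ht y hy hxy
  rw [← PiLp.sub_apply, ← PiLp.sub_apply, ht']
  exact hc.hasHorizontalTangents.abs_sub_le
    ((planeRotEquiv (-(k * Real.pi / 4))).lipschitz.comp hK) t t'

lemma IsEdgeCurve.exists_hasTangentLines (hα : 1 < α) (hα2 : α ≤ 2)
    (hc : IsEdgeCurve α k ℓ c) :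
    ∃ δ > 0, ∃ K, 0 ≤ K ∧ HasTangentLines α δ K (rotatedEdge k c) := by
  obtain ⟨K, hK⟩ := hc.exists_lipschitzWith ⟨hα.le, hα2⟩
  obtain ⟨δ, hδ, h⟩ := hc.exists_rotated_lift ⟨hα.le, hα2⟩
  obtain ⟨L, hL⟩ := hc.lipschitz
  have he : HasCurveExpansions α |2 * L| c := fun t =>
    ⟨(hL.hasCurveExpansions hα hα2 t).1, fun t' =>
      ((hL.hasCurveExpansions hα hα2 t).2 t').trans (by gcongr; exact le_abs_self _)⟩
  refine ⟨δ, hδ, 2 * |2 * L| * 2 ^ α, by positivity, fun p hp => ?_⟩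
  obtain ⟨t, ht⟩ := h p hp
  obtain ⟨θ, hθ, hθ'⟩ := (he.planeRot (-(k * Real.pi / 4))).abs_normalCoord_le (abs_nonneg _)
    (by linarith) hc.hasHorizontalTangents
    ((planeRotEquiv (-(k * Real.pi / 4))).lipschitz.comp hK) t
  refine ⟨θ, hθ, fun q hq hqp => ?_⟩
  obtain ⟨t', ht'⟩ := ht q hq hqp
  rw [ht']
  exact hθ' t'

end Rotated

/-! ### The convolution as an integral against the unscaled wavelet. -/

section Convolution

variable {ψ : Plane → ℂ} {M : ℝ} {f : Plane → ℝ}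

lemma integrable_wavelet (h : Integrable ψ) (k : ℕ) (j : ℤ) : Integrable (wavelet ψ k j) := by
  have h1 : Integrable fun u => ψ (planeRotEquiv (-(k * Real.pi / 4)) u) :=
    ((planeRotEquiv _).measurePreserving.integrable_comp_emb
      (planeRotEquiv _).toMeasurableEquiv.measurableEmbedding).2 h
  exact (h1.comp_smul (zpow_ne_zero _ two_ne_zero)).smul ((2 : ℝ) ^ (-2 * j))

lemma convolutionExistsAt_wavelet (h : Integrable ψ) (hm : AEStronglyMeasurable f)
    (hM : ∀ᵐ x, |f x| ≤ M) (k : ℕ) (j : ℤ) (u : Plane) :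
    ConvolutionExistsAt f (wavelet ψ k j) u (ContinuousLinearMap.lsmul ℝ ℝ) volume :=
  integrable_bounded_smul ((integrable_wavelet h k j).comp_sub_left u) hm hM

/-- Substitute x = 2^j r(w) with r the rotation by kπ/4: the Jacobian 2^(2j) cancels the
normalization of the wavelet. -/
lemma convolution_wavelet_eq (k : ℕ) (j : ℤ) (u : Plane) :
    convolution f (wavelet ψ k j) (ContinuousLinearMap.lsmul ℝ ℝ) volume u =
      ∫ w, f (planeRot (k * Real.pi / 4)
        (planeRot (-(k * Real.pi / 4)) u - (2 : ℝ) ^ j • w)) • ψ w := by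
  set φ := (k : ℝ) * Real.pi / 4 with hφ
  have h2 : (2 : ℝ) ^ j ≠ 0 := zpow_ne_zero _ two_ne_zero
  set H : Plane → ℂ := fun x => f (u - x) • wavelet ψ k j x with hH
  have e1 : convolution f (wavelet ψ k j) (ContinuousLinearMap.lsmul ℝ ℝ) volume u = ∫ x, H x := by
    rw [convolution, ← integral_sub_left_eq_self _ volume u]
    simp [hH]
  have e2 := Measure.integral_comp_smul volume H ((2 : ℝ) ^ j)
  have e3 : ∫ x, H x = (((2 : ℝ) ^ j) ^ 2) • ∫ x, H ((2 : ℝ) ^ j • x) := by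
    rw [e2, finrank_euclideanSpace_fin, abs_of_nonneg (by positivity), smul_smul,
      mul_inv_cancel₀ (pow_ne_zero _ h2), one_smul]
  rw [e1, e3, ← integral_smul,
    ← (planeRotEquiv φ).measurePreserving.integral_comp'
      (f := (planeRotEquiv φ).toMeasurableEquiv)]
  refine integral_congr_ae (Filter.Eventually.of_forall fun w => ?_)
  change ((2 : ℝ) ^ j) ^ 2 • H ((2 : ℝ) ^ j • planeRot φ w) = _
  simp only [hH, wavelet]
  rw [← hφ, smul_smul ((2 : ℝ) ^ (-j)), ← zpow_add₀ two_ne_zero, neg_add_cancel, zpow_zero,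
    one_smul, planeRot_neg_planeRot, planeRot_sub, planeRot_planeRot_neg, planeRot_smul,
    smul_comm]
  have : ((2 : ℝ) ^ j) ^ 2 * (2 : ℝ) ^ (-2 * j) = 1 := by
    rw [← zpow_natCast, ← zpow_mul, ← zpow_add₀ two_ne_zero]
    norm_num
    ring_nf
    simp
  rw [smul_smul (((2 : ℝ) ^ j) ^ 2), this, one_smul]

end Convolution

/-! ### Choice of exponents and conclusion. -/

lemma rpow_le_of_exponent_le {ε T a b : ℝ} (hε : 0 < ε) (hT : ε ≤ T) (hab : a ≤ b) :
    ε ^ b ≤ T ^ (b - a) * ε ^ a := by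
  have : ε ^ b = ε ^ (b - a) * ε ^ a := by rw [← Real.rpow_add hε, sub_add_cancel]
  rw [this]
  gcongr

/-- Choosing the localization radius `ρ = ε ^ (s / α)`. -/
lemma exists_exponent_bound {α s T : ℝ} (hα : 1 < α) (hα2 : α ≤ 2) (hs : s < α)
    (hT : 0 < T) : ∃ (N : ℕ) (C : ℝ), 0 ≤ C ∧ ∀ ε, 0 < ε → ε ≤ T →
      ε ^ (s / α) + (ε ^ (s / α) / ε) ^ (-(N : ℝ)) + (ε ^ (s / α)) ^ α / ε ≤ C * ε ^ (s - 1) := by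
  have hα0 : 0 < α := by linarith
  have hη : 0 < 1 - s / α := by
    rw [sub_pos, div_lt_one hα0]; exact hs
  -- The tail is ε^(N(1 - s/α)); this N makes its exponent at least 1, which exceeds s - 1.
  obtain ⟨N, hN⟩ := exists_nat_ge (1 / (1 - s / α))
  rw [div_le_iff₀ hη] at hN
  refine ⟨N, T ^ (s / α - (s - 1)) + T ^ ((1 - s / α) * N - (s - 1)) + 1, by positivity,
    fun ε hε hεT => ?_⟩
  have h1 : ε ^ (s / α) ≤ T ^ (s / α - (s - 1)) * ε ^ (s - 1) := by
    refine rpow_le_of_exponent_le hε hεT ?_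
    rw [le_div_iff₀ hα0]
    nlinarith
  have h2 : (ε ^ (s / α) / ε) ^ (-(N : ℝ)) ≤
      T ^ ((1 - s / α) * N - (s - 1)) * ε ^ (s - 1) := by
    have : (ε ^ (s / α) / ε) ^ (-(N : ℝ)) = ε ^ ((1 - s / α) * N) := by
      have e : ε ^ (s / α) / ε = ε ^ (s / α - 1) := by rw [Real.rpow_sub_one hε.ne']
      rw [e, ← Real.rpow_mul hε.le]
      ring_nf
    rw [this]
    refine rpow_le_of_exponent_le hε hεT ?_
    linarith
  have h3 : (ε ^ (s / α)) ^ α / ε = ε ^ (s - 1) := by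
    rw [← Real.rpow_mul hε.le, div_mul_cancel₀ _ hα0.ne', Real.rpow_sub_one hε.ne']
  rw [h3]
  linarith

end

open MeasureTheory in
theorem theorem1 (ψ : Plane → ℂ) (hψ_smooth : ContDiff ℝ 2 ψ)
    (hψ_moments : HasVanishingMoments 2 ψ)
    (hψ_directional :
      HasDirectionalVanishingMoments 2 (Set.Icc (-(Real.pi / 4)) (Real.pi / 4)) ψ)
    (hψ_decay : HasRapidDecay ψ)
    (α : ℝ) (hα : α ∈ Set.Icc (1 : ℝ) 2) (k : ℕ) (hk : k < 4)
    (f : Plane → ℝ) (hf_periodic : IsPeriodicImage f)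
    (ℓ : ℝ) (c : ℝ → Plane) (hc : IsEdgeCurve α k ℓ c)
    (hf : IsRegularAwayFromEdge α c f) (J : ℤ) :
    ∀ s : ℝ, s < α → ∃ C : ℝ, ∀ j : ℤ, j ≤ J → ∀ u : Plane,
      MeasureTheory.ConvolutionExistsAt f (wavelet ψ k j) u
          (ContinuousLinearMap.lsmul ℝ ℝ) MeasureTheory.volume ∧
        ‖MeasureTheory.convolution f (wavelet ψ k j)
            (ContinuousLinearMap.lsmul ℝ ℝ) MeasureTheory.volume u‖
          ≤ C * (2 : ℝ) ^ ((s - 1) * (j : ℝ)) := by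
  intro s hs
  have hcont := hψ_smooth.continuous
  have hi := hψ_decay.integrable hcont
  obtain ⟨δ, hδ, hslope⟩ := hc.exists_hasLocalSlopeBound hα
  have hcl := hc.isClosed_rotatedEdge hα
  have h0 := hslope.volume_eq_zero hδ hcl
  obtain ⟨L, hL, hreg'⟩ := hf.exists_isSegmentRegular (by linarith [hα.1]) hα.2
  have hreg := hreg'.comp_planeRot (k * Real.pi / 4)
  have hm := hreg.aestronglyMeasurable (by linarith [hα.1]) hcl h0
  -- The rotated image is periodic for a rotated lattice, so periodicity enters only through the
  -- fact that every value off the edge is attained in a fixed ball.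
  obtain ⟨M, hM0, hM⟩ := hreg.exists_bound hδ hslope (by linarith [hα.1]) hL (R := 2) <| by
    intro x hx
    obtain ⟨y, hy, hy2, hyf⟩ := exists_norm_le_of_periodic hf_periodic hx
    refine ⟨planeRot (-(k * Real.pi / 4)) y, ?_, by rwa [norm_planeRot], ?_⟩
    · rwa [rotatedEdge, Set.mem_preimage, planeRot_planeRot_neg]
    · rwa [planeRot_planeRot_neg]
  have hR := (planeRotEquiv (-(k * Real.pi / 4))).measurePreserving.quasiMeasurePreserving
  have hae : ∀ᵐ x, |f x| ≤ M := by
    filter_upwards [hR.ae ((measure_eq_zero_iff_ae_notMem.1 h0).mono hM)] with x hx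
    simpa [planeRot_planeRot_neg] using hx
  have hmf : AEStronglyMeasurable f := by
    have := hm.comp_quasiMeasurePreserving hR
    simpa [Function.comp_def, planeRot_planeRot_neg] using this
  have hbd : ∀ j : ℤ, ∀ u, ‖convolution f (wavelet ψ k j) (ContinuousLinearMap.lsmul ℝ ℝ)
      volume u‖ ≤ M * ∫ w, ‖ψ w‖ := by
    intro j u
    rw [convolution_wavelet_eq, ← integral_const_mul]
    refine norm_integral_le_of_norm_le (hi.norm.const_mul M) ?_
    filter_upwards [(quasiMeasurePreserving_sub_smul (planeRot (-(k * Real.pi / 4)) u)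
      (zpow_pos two_pos j)).ae ((measure_eq_zero_iff_ae_notMem.1 h0).mono hM)] with w hw
    rw [norm_smul]
    gcongr
    exact hw
  have h2j : ∀ j : ℤ, (2 : ℝ) ^ ((s - 1) * (j : ℝ)) = ((2 : ℝ) ^ j) ^ (s - 1) := by
    intro j
    rw [mul_comm, Real.rpow_mul two_pos.le, Real.rpow_intCast]
  have hjJ : ∀ j : ℤ, j ≤ J → (2 : ℝ) ^ j ≤ (2 : ℝ) ^ J := fun j hj =>
    zpow_le_zpow_right₀ one_le_two hj
  suffices h : ∃ C, ∀ j : ℤ, j ≤ J → ∀ u,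
      ‖convolution f (wavelet ψ k j) (ContinuousLinearMap.lsmul ℝ ℝ) volume u‖ ≤
        C * ((2 : ℝ) ^ j) ^ (s - 1) by
    obtain ⟨C, hC⟩ := h
    exact ⟨C, fun j hj u => ⟨convolutionExistsAt_wavelet hi hmf hae k j u, by
      rw [h2j]; exact hC j hj u⟩⟩
  -- For s < 1 the uniform bound suffices, which includes all of α = 1; tangent lines are needed
  -- only for s ≥ 1, where α > 1.
  rcases lt_or_ge s 1 with hs1 | hs1
  · refine ⟨(M * ∫ w, ‖ψ w‖) * ((2 : ℝ) ^ J) ^ (0 - (s - 1)), fun j hj u => (hbd j u).trans ?_⟩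
    have h := rpow_le_of_exponent_le (zpow_pos two_pos j) (hjJ j hj)
      (by linarith : s - 1 ≤ 0)
    rw [Real.rpow_zero] at h
    rw [mul_assoc]
    exact le_mul_of_one_le_right (by positivity) h
  · have hα1 : 1 < α := hs1.trans_lt hs
    obtain ⟨A, hA, hLip⟩ := hreg.exists_lipschitz hδ hslope hα.1 hL hM
    obtain ⟨δ', hδ', K, hK, hT⟩ := hc.exists_hasTangentLines hα1 hα.2
    obtain ⟨N, C, hC, hexp⟩ := exists_exponent_bound hα1 hα.2 hs
      (zpow_pos two_pos J : 0 < (2 : ℝ) ^ J)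
    obtain ⟨D, hD, hbound⟩ := exists_bound_integral_edge hcont hψ_decay hψ_moments hψ_directional
      h0 hm hM0 hM hA hLip (by linarith) hK hδ' hT N
    refine ⟨D * C, fun j hj u => ?_⟩
    have hpos : 0 < (2 : ℝ) ^ j := zpow_pos two_pos j
    rw [convolution_wavelet_eq]
    refine (hbound ((2 : ℝ) ^ j) (((2 : ℝ) ^ j) ^ (s / α)) hpos (by positivity) _).trans ?_
    rw [mul_assoc]
    gcongr
    exact hexp _ hpos (hjJ j hj)
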